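/- Let $F$ be a Ferrers shape in French notation (rows are numbered from bottom to top, columns from left to right), and fill each cell of $F$ with a non-negative integer. The corners of the cells of $F$ are labelled by partitions as follows (growth diagram of the fourth variant "dual RSK$'$" of the Robinson–Schensted–Knuth correspondence, also called Burge correspondence). (a) *Separation.* Refine the rows and columns of $F$ to obtain an augmented Ferrers shape, and replace each entry $m$ by $m$ crosses in the block of small cells which comes from its cell, so that every small row and every small column contains at most one cross: the $m$ crosses form a chain from top/left to bottom/right, the chains coming from the entries of the same column of $F$ are arranged from top/left to bottom/right, and likewise for the chains coming from the entries of the same row of $F$. (b) *Growth.* Label all corners along the left side and the bottom side of the augmented shape by the empty partition $\emptyset$, and label the other corners successively by the forward local rules: if a small cell has the labels $\rho$ (bottom left), $\mu$ (bottom right), $\nu$ (top left), then its top right label $\lambda$ is: $\rho$ if $\rho=\mu=\nu$ and the cell has no cross; $\rho$ with a square added to its first row if $\rho=\mu=\nu$ and the cell has a cross; $\nu$ if $\rho=\mu\neq\nu$; $\mu$ if $\rho=\nu\ne\mu$; $\mu\cup\nu$ if $\rho,\mu,\nu$ are pairwise different; and, if $\rho\neq\mu=\nu$, where $\mu$ and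 $\rho$ differ in the $k$-th row, $\mu$ with a square added to its $(k+1)$-st row. (c) *Shrinking back.* Each corner of a cell of $F$ receives the label of the corresponding corner of the augmented shape. A *ne-chain* is a sequence of non-zero entries of the filling in which each entry lies strictly above and strictly to the right of the preceding one; its length is its number of entries. A *SE-chain* is a sequence of non-zero entries in distinct cells in which each entry lies weakly below and weakly to the right of the preceding one; its length is the sum of its entries. Chains may be empty. **Theorem.** Let $\lambda=(\lambda_1,\lambda_2,\dots)$ be the label of a corner $c$, and let $\lambda'$ be the conjugate partition. Consider only chains situated in the rectangular region to the left and below of $c$. Then: 1. For any $k$, the maximal cardinality of the multiset union (that is, the maximal sum of the cardinalities) of a collection of $k$ ne-chains with the property that no entry $e$ is in more than $e$ of these ne-chains is equal to $\lambda_1+\lambda_2+\dots+\lambda_k$. 2. For any $k$, the maximal sum of all the entries in a collection of $k$ pairwise disjoint SE-chains is equal to $\lambda'_1+\lambda'_2+\dots+\lambda'_k$. In particular, $\lambda_1$ is the length of the longest ne-chain, and $\lambda'_1$ is the length of the longest SE-chain, in this region. -/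

import Mathlib

namespace DualRSK

/-! Ferrers shapes are drawn in French notation: `(i, j) ∈ F` is the cell in row `i`, counted from
the bottom, and column `j`, counted from the left, both starting with `0`.  The corner `(r, s)` is
the lattice point at height `r` and at horizontal position `s`, so that the cell `(i, j)` has the
corners `(i, j)`, `(i, j + 1)`, `(i + 1, j)`, `(i + 1, j + 1)`.

Partitions are Young diagrams; the `i`-th part of `lam`, starting with `i = 0`, is
`lam.rowLen i`, which is `0` for large `i`. -/

/-- A filling of the cells of the Ferrers shape `F` with non-negative integers
(extended by `0` outside of `F`). -/
structure Filling (F : YoungDiagram) where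
  entry : ℕ → ℕ → ℕ
  zeros : ∀ i j, (i, j) ∉ F → entry i j = 0

/-- `(r, s)` is one of the four corners of some cell of `F`. -/
def IsCorner (F : YoungDiagram) (r s : ℕ) : Prop :=
  ∃ i j, (i, j) ∈ F ∧ (r = i ∨ r = i + 1) ∧ (s = j ∨ s = j + 1)

/-! ### Forward local rules and growth diagrams of 0-1-fillings -/

open Classical in
/-- The partition formed by adding a square to row `i` of `mu`
(`mu` itself if the result would not be a partition; this never happens below). -/
noncomputable def addSquare (mu : YoungDiagram) (i : ℕ) : YoungDiagram :=
  if h : IsLowerSet (↑(insert (i, mu.rowLen i) mu.cells) : Set (ℕ × ℕ)) then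
    ⟨insert (i, mu.rowLen i) mu.cells, h⟩
  else mu

open Classical in
/-- The forward local rules. A cell has the labels `rho` at its bottom left corner, `mu` at its
bottom right corner and `nu` at its top left corner; `cross` says that there is a cross in the
cell. The value is the label of the top right corner. -/
noncomputable def forwardRule (cross : Prop) (rho mu nu : YoungDiagram) : YoungDiagram :=
  if rho = mu ∧ rho = nu then
    if cross then addSquare rho 0 else rho
  else if rho = mu then nu
  else if rho = nu then mu
  else if mu ≠ nu then mu ⊔ nu
  else addSquare mu (sInf {k | mu.rowLen k ≠ rho.rowLen k} + 1)

/-- The label of the corner `(r, s)` in the growth diagram of the 0-1-filling with crosses `X`,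
with empty partitions along the left side and along the bottom side. It depends only on
the crosses in the rectangle to the left and below of the corner. -/
noncomputable def growthLabel (X : ℕ → ℕ → Prop) : ℕ → ℕ → YoungDiagram
  | 0, _ => ⊥
  | _ + 1, 0 => ⊥
  | r + 1, s + 1 =>
      forwardRule (X r s) (growthLabel X r s) (growthLabel X r (s + 1)) (growthLabel X (r + 1) s)
termination_by r s => (r, s)

/-! ### Separation of the entries of a filling -/

namespace Filling

variable {F : YoungDiagram}

/-- The number of rows of the augmented diagram that replace row `i`:
the sum of the entries in the row (a row of zeros stays a single row). -/
def rowHeight (f : Filling F) (i : ℕ) : ℕ :=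
  max 1 (∑ j ∈ Finset.range (F.rowLen i), f.entry i j)

/-- The number of columns of the augmented diagram that replace column `j`. -/
def colWidth (f : Filling F) (j : ℕ) : ℕ :=
  max 1 (∑ i ∈ Finset.range (F.colLen j), f.entry i j)

/-- The height in the augmented diagram of the original horizontal line at height `r`. -/
def rowStart (f : Filling F) (r : ℕ) : ℕ := ∑ i ∈ Finset.range r, f.rowHeight i

/-- The position in the augmented diagram of the original vertical line at position `s`. -/
def colStart (f : Filling F) (s : ℕ) : ℕ := ∑ j ∈ Finset.range s, f.colWidth j

/-- The crosses of the augmented diagram, `(x, y)` being its cell in row `x` and column `y`.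
An entry `m` becomes a chain of `m` crosses (`t = 0, …, m - 1`) from top/left to bottom/right,
and so do the chains of the entries in the same column, and of those in the same row.
Hence cross number `t` of the cell `(i, j)` has to its left, within column `j`, the crosses of the
cells above, and `t` crosses of its own cell; it has above it, within row `i`, the crosses of
the cells to the left, and `t` crosses of its own cell. -/
def AugmentedCross (f : Filling F) (x y : ℕ) : Prop :=
  ∃ i j t, t < f.entry i j ∧
    x + ((∑ j' ∈ Finset.range j, f.entry i j') + t) + 1 = f.rowStart i + f.rowHeight i ∧
    y = f.colStart j + (∑ i' ∈ Finset.Ico (i + 1) (F.colLen j), f.entry i' j) + t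

/-- The label of the corner `(r, s)` in the diagram of `f`, with empty partitions along the left
side and the bottom side, completed according to the fourth variant of RSK (dual RSK-prime, or
Burge): separate the entries, complete the augmented diagram by the forward rules, and
shrink back to the original lines. -/
noncomputable def label (f : Filling F) (r s : ℕ) : YoungDiagram :=
  growthLabel f.AugmentedCross (f.rowStart r) (f.colStart s)

/-! ### Chains -/

/-- `C` is the set of cells of a ne-chain of `f`: a sequence of non-zero entries, each strictly
above and strictly to the right of the preceding one, situated in the rectangle to the left and
below of the corner `(r, s)`. -/
def IsNeChain (f : Filling F) (r s : ℕ) (C : Finset (ℕ × ℕ)) : Prop :=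
  (∀ p ∈ C, p.1 < r ∧ p.2 < s ∧ f.entry p.1 p.2 ≠ 0) ∧
  IsChain (fun p q : ℕ × ℕ => p.1 < q.1 ∧ p.2 < q.2) (C : Set (ℕ × ℕ))

/-- `C` is the set of cells of a SE-chain of `f`: a sequence of non-zero entries (in distinct
cells), each weakly below and weakly to the right of the preceding one, situated in the
rectangle to the left and below of the corner `(r, s)`. -/
def IsSEChain (f : Filling F) (r s : ℕ) (C : Finset (ℕ × ℕ)) : Prop :=
  (∀ p ∈ C, p.1 < r ∧ p.2 < s ∧ f.entry p.1 p.2 ≠ 0) ∧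
  IsChain (fun p q : ℕ × ℕ => q.1 ≤ p.1 ∧ p.2 ≤ q.2) (C : Set (ℕ × ℕ))

/-- A collection of `k` ne-chains such that no entry `e` is in more than `e` of them. -/
def IsNeCollection (f : Filling F) (r s k : ℕ) (C : Fin k → Finset (ℕ × ℕ)) : Prop :=
  (∀ a, f.IsNeChain r s (C a)) ∧
  ∀ i j, (Finset.univ.filter fun a => (i, j) ∈ C a).card ≤ f.entry i j

/-- A collection of `k` pairwise disjoint SE-chains. -/
def IsSECollection (f : Filling F) (r s k : ℕ) (C : Fin k → Finset (ℕ × ℕ)) : Prop :=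
  (∀ a, f.IsSEChain r s (C a)) ∧ ∀ a b, a ≠ b → Disjoint (C a) (C b)

/-- The sum of the entries of `f` in the cells of `C`. -/
def entrySum (f : Filling F) (C : Finset (ℕ × ℕ)) : ℕ := ∑ p ∈ C, f.entry p.1 p.2

end Filling

end DualRSK

/-! This is Greene's theorem, but only lower bounds are carried along Knuth moves; the upper bounds
come from a duality between the two kinds of chains.

Along a horizontal line of the augmented diagram the labels grow by at most one square at a time,
and the columns at which row `i` grows form row `i` of a tableau (`tableauRow`). Passing to the next
line, with a cross in column `c`, the local rules perform the row insertion of `c`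
(`exists_isInsertion`). Undoing the insertions by Knuth moves leads from the reading word of the
tableau to the word of the columns of the crosses (`crossWord`), and unions of `k` increasing or of
`k` decreasing subsequences survive every move without loss of size (`Dominated`). In the tableau,
`k` rows and `k` columns are such unions, of sizes $\lambda_1+\dots+\lambda_k$ and
$\lambda'_1+\dots+\lambda'_k$ (`hasColoring_crossWord`).

Separation is arranged so that increasing pairs of crosses come from cells in strict ne-position,
and decreasing pairs from cells in weak SE-position. So the subsequences project to ne-chains and
SE-chains, and both claimed values are reached.

A ne-chain and a SE-chain share at most one cell. Hence `k` ne-chains and `l` SE-chains have total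
size at most $N+kl$, where $N\le|\lambda|$ is the sum of the entries in the region
(`card_add_entrySum_le`). For $l=\lambda_{k+1}$, the first `k` rows and the first `l` columns cover
$\lambda$ and overlap in $kl$ squares (`card_add_mul_le`). As `l` SE-chains reach the column sum,
`k` ne-chains cannot exceed the row sum; the other bound is symmetric. -/

namespace DualRSK

/-! ### Coloured subsequences under Knuth moves -/

/-- `w` has a `k`-coloured set of at least `n` letters, such that the occurrences of letters of
the same colour are in increasing order. -/
def HasColoring (w : List ℕ) (k n : ℕ) : Prop :=
  ∃ (S : Finset ℕ) (f : ℕ → ℕ), S ⊆ w.toFinset ∧ n ≤ S.card ∧ (∀ x ∈ S, f x < k) ∧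
    w.Pairwise (fun x y => x ∈ S → y ∈ S → f x = f y → x < y)

/-- A descent never has both letters in one colour, so exchanging them spoils no colour class. -/
theorem HasColoring.swap_descent {u v : List ℕ} {c x k n : ℕ} (h : c < x)
    (hw : HasColoring (u ++ x :: c :: v) k n) : HasColoring (u ++ c :: x :: v) k n := by
  obtain ⟨S, f, hS, hn, hf, hp⟩ := hw
  refine ⟨S, f, fun z hz => ?_, hn, hf, ?_⟩
  · have := hS hz
    simp only [List.mem_toFinset, List.mem_append, List.mem_cons] at this ⊢
    tauto
  · simp only [List.pairwise_append, List.pairwise_cons, List.mem_cons] at hp ⊢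
    grind

/-- Only the case where `c` and `x` share a colour is in danger; the neighbour `y`, of intermediate
size, then permits a repair that keeps the number of letters. -/
theorem HasColoring.swap_ascent {u v : List ℕ} {c y x k n : ℕ} (hcy : c < y) (hyx : y < x)
    (hnd : (u ++ y :: c :: x :: v).Nodup)
    (hw : HasColoring (u ++ y :: c :: x :: v) k n) : HasColoring (u ++ y :: x :: c :: v) k n := by
  obtain ⟨S, f, hS, hn, hf, hp⟩ := hw
  have hnd' : ∀ z ∈ u, z ≠ y ∧ z ≠ c ∧ z ≠ x ∧ z ∉ v := by
    intro z hz
    have := (List.nodup_append.1 hnd).2.2 z hz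
    simp only [List.mem_cons] at this
    exact ⟨this y (by simp), this c (by simp), this x (by simp), fun h => this z (by simp [h]) rfl⟩
  have hv : ∀ z ∈ v, z ≠ y ∧ z ≠ c ∧ z ≠ x := by
    intro z hz
    have := (List.nodup_append.1 hnd).2.1
    simp only [List.nodup_cons, List.mem_cons, not_or] at this
    refine ⟨?_, ?_, ?_⟩ <;> rintro rfl <;> tauto
  have hS' : ∀ z ∈ S, z ∈ (u ++ y :: x :: c :: v).toFinset := fun z hz => by
    have := hS hz
    simp only [List.mem_toFinset, List.mem_append, List.mem_cons] at this ⊢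
    tauto
  simp only [List.pairwise_append, List.pairwise_cons, List.mem_cons, forall_eq_or_imp] at hp
  obtain ⟨hpu, ⟨⟨hyc, hyx', hyv⟩, ⟨hcx, hcv⟩, hxv, hpv⟩, huv⟩ := hp
  by_cases hcx' : c ∈ S ∧ x ∈ S ∧ f c = f x
  swap
  · refine ⟨S, f, hS', hn, hf, ?_⟩
    simp only [List.pairwise_append, List.pairwise_cons, List.mem_cons, forall_eq_or_imp]
    refine ⟨hpu, ⟨⟨hyx', hyc, hyv⟩, ⟨?_, hxv⟩, hcv, hpv⟩, fun z hz => ?_⟩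
    · intro h1 h2 h3; exact absurd ⟨h2, h1, h3.symm⟩ hcx'
    · obtain ⟨h1, h2, h3, h4⟩ := huv z hz
      exact ⟨h1, h3, h2, h4⟩
  obtain ⟨hc, hx, hfcx⟩ := hcx'
  by_cases hy : y ∈ S
  · have hfy : f y ≠ f c := fun h => absurd (hyc hy hc h) (by omega)
    -- The classes of `y` and `c` differ, since `y` precedes `c` and is larger. They exchange their
    -- tails: `x` and what follows it in its class now continue `y`, and the former tail of `y`, all
    -- of it above `y > c`, continues `c`.
    refine ⟨S, fun z => if z ∈ v ∨ z = x then Equiv.swap (f c) (f y) (f z) else f z,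
      hS', hn, fun z hz => ?_, ?_⟩
    · have h1 := hf z hz
      have h2 := hf c hc
      have h3 := hf y hy
      simp only [Equiv.swap_apply_def]
      split_ifs <;> omega
    have key : ∀ z ∈ v, z ∈ S → f z = f c → x < z := fun z hz hzS h =>
      hxv z hz hx hzS (by omega)
    have key2 : ∀ z ∈ v, z ∈ S → f z = f y → y < z := fun z hz hzS h =>
      hyv z hz hy hzS (by omega)
    have hyv' : y ∉ v := fun h => (hv y h).1 rfl
    have hcv' : c ∉ v := fun h => (hv c h).2.1 rfl
    have hyx'' : y ≠ x := by omega
    have hcx'' : c ≠ x := by omega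
    simp only [List.pairwise_append, List.pairwise_cons, List.mem_cons, forall_eq_or_imp]
    refine ⟨?_, ⟨⟨fun _ _ _ => hyx, ?_, ?_⟩, ⟨?_, ?_⟩, ?_, ?_⟩, ?_⟩
    · refine hpu.imp_of_mem fun {a b} ha hb h => ?_
      have h1 := hnd' a ha
      have h2 := hnd' b hb
      simpa [h1, h2] using h
    · simpa [hyv', hcv', hyx'', hcx''] using hyc
    · intro z hz h1 h2 h3
      simp only [hyv', hyx'', or_self, if_false, hz, true_or, if_true,
        Equiv.swap_apply_def] at h3
      split_ifs at h3 with h4 h5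
      · exact hyx.trans (key z hz h2 h4)
      · omega
      · omega
    · intro _ _ h
      simp [hcv', hcx'', ← hfcx, hfy] at h
    · intro z hz h1 h2 h3
      simp only [hz, or_true, true_or, if_true, EmbeddingLike.apply_eq_iff_eq] at h3
      exact hxv z hz h1 h2 h3
    · intro z hz h1 h2 h3
      simp only [hcv', hcx'', or_self, if_false, hz, true_or, if_true,
        Equiv.swap_apply_def] at h3
      split_ifs at h3 with h4 h5
      · omega
      · exact hcy.trans (key2 z hz h2 h5)
      · omega
    · refine hpv.imp_of_mem fun {a b} ha hb h => ?_
      simpa [ha, hb] using h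
    · intro z hz
      obtain ⟨h1, h2, h3, h4⟩ := huv z hz
      have h5 := hnd' z hz
      refine ⟨by simpa [h5, hyv', hyx''] using h1, ?_, by simpa [h5, hcv', hcx''] using h2, ?_⟩
      · intro h6 _ h7
        simp only [h5, or_self, if_false, or_true, if_true, ← hfcx, Equiv.swap_apply_left] at h7
        exact (h1 h6 hy h7).trans hyx
      · intro b hb h6 h7 h8
        simp only [h5, or_self, if_false, hb, true_or, if_true, Equiv.swap_apply_def] at h8
        split_ifs at h8 with h9 h10
        · exact ((h1 h6 hy h8).trans hyx).trans (key b hb h7 h9)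
        · exact ((h2 h6 hc h8).trans hcy).trans (key2 b hb h7 h10)
        · exact h4 b hb h6 h7 h8
  -- As `y` is free, it replaces `c` in the class of `c` and `x`; what precedes is below `c < y`,
  -- what follows is at least `x > y`.
  · refine ⟨insert y (S.erase c), Function.update f y (f c), fun z hz => ?_, ?_, fun z hz => ?_, ?_⟩
    · rcases Finset.mem_insert.1 hz with rfl | hz
      · simp
      · exact hS' z (Finset.mem_of_mem_erase hz)
    · rw [Finset.card_insert_of_notMem (fun h => hy (Finset.mem_of_mem_erase h)),
        Finset.card_erase_add_one hc]
      exact hn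
    · rcases Finset.mem_insert.1 hz with rfl | hz
      · simpa using hf c hc
      · have hz' := Finset.mem_of_mem_erase hz
        rw [Function.update_of_ne (by rintro rfl; exact hy hz')]
        exact hf z hz'
    have hxy : x ≠ y := by omega
    have hcy' : c ≠ y := by omega
    have hxc : x ≠ c := by omega
    simp only [List.pairwise_append, List.pairwise_cons, List.mem_cons, forall_eq_or_imp]
    refine ⟨?_, ⟨⟨fun _ _ _ => hyx, ?_, ?_⟩, ⟨?_, ?_⟩, ?_, ?_⟩, ?_⟩
    · refine hpu.imp_of_mem fun {a b} ha hb h => ?_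
      have h1 := hnd' a ha
      have h2 := hnd' b hb
      simpa [h1, h2] using h
    · simp [hcy']
    · intro z hz _ h2 h3
      have h1 := hv z hz
      simp only [Finset.mem_insert, h1, Finset.mem_erase, ne_eq, not_false_eq_true, true_and,
        false_or] at h2
      rw [Function.update_self, Function.update_of_ne h1.1] at h3
      exact hyx.trans (hxv z hz hx h2 (by omega))
    · simp [hcy']
    · intro z hz h1 h2 h3
      have h4 := hv z hz
      refine hxv z hz hx ?_ ?_
      · simpa [h4] using h2
      · simpa [h4, hxy] using h3
    · simp [hcy']
    · refine hpv.imp_of_mem fun {a b} ha hb h => ?_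
      have h1 := hv a ha
      have h2 := hv b hb
      simpa [h1, h2] using h
    · intro z hz
      obtain ⟨h1, h2, h3, h4⟩ := huv z hz
      have h5 := hnd' z hz
      refine ⟨?_, by simpa [h5, hxy, hxc] using h3, by simp [hcy'], fun b hb => ?_⟩
      · intro h6 _ h7
        simp only [Function.update_self, Function.update_of_ne h5.1] at h7
        exact (h2 (by simpa [h5] using h6) hc h7).trans hcy
      · have h6 := hv b hb
        simpa [h5, h6] using h4 b hb

/-- Both the increasing and the decreasing colourings of `w` carry over to `w'`. -/
def Dominated (w w' : List ℕ) : Prop :=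
  ∀ k n, (HasColoring w k n → HasColoring w' k n) ∧
    (HasColoring w.reverse k n → HasColoring w'.reverse k n)

theorem Dominated.refl (w : List ℕ) : Dominated w w := fun _ _ => ⟨id, id⟩

theorem Dominated.trans {w w' w'' : List ℕ} (h : Dominated w w') (h' : Dominated w' w'') :
    Dominated w w'' :=
  fun k n => ⟨(h' k n).1 ∘ (h k n).1, (h' k n).2 ∘ (h k n).2⟩

/-- Reversal turns one elementary Knuth move into the other, so decreasing colourings are covered by
the harmless swap of a descent. -/
theorem Dominated.knuth_left {u v : List ℕ} {c y x : ℕ} (hcy : c < y) (hyx : y < x)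
    (hnd : (u ++ y :: c :: x :: v).Nodup) :
    Dominated (u ++ y :: c :: x :: v) (u ++ y :: x :: c :: v) := by
  refine fun k n => ⟨HasColoring.swap_ascent hcy hyx hnd, fun h => ?_⟩
  simp only [List.reverse_append, List.reverse_cons, List.append_assoc, List.cons_append,
    List.nil_append] at h ⊢
  exact h.swap_descent (hcy.trans hyx)

theorem Dominated.knuth_right {u v : List ℕ} {c y x : ℕ} (hcy : c < y) (hyx : y < x)
    (hnd : (u ++ x :: c :: y :: v).Nodup) :
    Dominated (u ++ x :: c :: y :: v) (u ++ c :: x :: y :: v) := by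
  refine fun k n => ⟨HasColoring.swap_descent (hcy.trans hyx), fun h => ?_⟩
  have hnd' := List.nodup_reverse.2 hnd
  simp only [List.reverse_append, List.reverse_cons, List.append_assoc, List.cons_append,
    List.nil_append] at h hnd' ⊢
  exact h.swap_ascent hcy hyx hnd'

/-! ### Row insertion as a sequence of Knuth moves -/

theorem Dominated.move_right {p q : List ℕ} {c b : ℕ} (hcb : c < b) (u : List ℕ)
    (hu : (b :: u).SortedLT) (hnd : (p ++ b :: c :: u ++ q).Nodup) :
    Dominated (p ++ b :: c :: u ++ q) (p ++ b :: u ++ c :: q) := by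
  induction u generalizing p b with
  | nil => simpa using Dominated.refl _
  | cons x u ih =>
    have hbx : b < x := by
      have := List.sortedLT_iff_pairwise.1 hu
      simp at this; exact this.1.1
    have h1 : Dominated (p ++ b :: c :: x :: u ++ q) (p ++ b :: x :: c :: u ++ q) := by
      have := Dominated.knuth_left (u := p) (v := u ++ q) hcb hbx (by simpa using hnd)
      simpa using this
    refine h1.trans ?_
    have := ih (p := p ++ [b]) (hcb.trans hbx)
      (by rw [List.sortedLT_iff_pairwise] at hu ⊢; exact hu.of_cons)
      (by
        refine (List.Perm.nodup_iff ?_).1 hnd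
        simp only [List.append_assoc, List.cons_append, List.nil_append]
        exact List.Perm.append_left _ (List.Perm.cons _ (List.Perm.swap _ _ _)))
    simpa using this

/-- The bumped letter `b` passes each letter `x` of `u`; the letter `y` after `x`, which is `c` at
the end, is the intermediate witness `x < y < b` of the Knuth move. -/
theorem Dominated.move_left {p q : List ℕ} {c b : ℕ} (hcb : c < b) (u : List ℕ)
    (hu : (u ++ [c]).SortedLT) (hnd : (p ++ b :: u ++ c :: q).Nodup) :
    Dominated (p ++ b :: u ++ c :: q) (p ++ u ++ b :: c :: q) := by
  induction u generalizing p with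
  | nil => simpa using Dominated.refl _
  | cons x u ih =>
    obtain ⟨y, t, hyt, hxy, hyb⟩ : ∃ y t, u ++ c :: q = y :: t ∧ x < y ∧ y < b := by
      have := List.sortedLT_iff_pairwise.1 hu
      cases u with
      | nil => exact ⟨c, q, rfl, by simpa using this, hcb⟩
      | cons y u =>
        simp only [List.cons_append, List.pairwise_cons, List.mem_cons, List.mem_append] at this
        exact ⟨y, u ++ c :: q, rfl, this.1 y (by simp), (this.2.1 c (by simp)).trans hcb⟩
    have h1 : Dominated (p ++ b :: x :: u ++ c :: q) (p ++ x :: b :: u ++ c :: q) := by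
      simp only [List.append_assoc, List.cons_append, hyt] at hnd ⊢
      exact Dominated.knuth_right hxy hyb hnd
    refine h1.trans ?_
    have := ih (p := p ++ [x])
      (by rw [List.sortedLT_iff_pairwise] at hu ⊢; exact hu.of_cons)
      (by
        refine (List.Perm.nodup_iff ?_).1 hnd
        simp only [List.append_assoc, List.cons_append, List.nil_append]
        exact List.Perm.append_left _ (List.Perm.swap _ _ _))
    simpa using this

/-- Inserting `c` into the row `u ++ b :: v`, where `b` is bumped. -/
theorem Dominated.row_insert {p q u v : List ℕ} {c b : ℕ} (hcb : c < b)
    (hu : (u ++ [c]).SortedLT) (hv : (b :: v).SortedLT)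
    (hnd : (p ++ b :: u ++ c :: v ++ q).Nodup) :
    Dominated (p ++ b :: u ++ c :: v ++ q) (p ++ u ++ b :: v ++ c :: q) := by
  have h1 := Dominated.move_left (p := p) (q := v ++ q) hcb u hu (by simpa using hnd)
  have h2 := Dominated.move_right (p := p ++ u) (q := q) hcb v hv (by
    refine (List.Perm.nodup_iff ?_).1 hnd
    simp only [List.append_assoc, List.cons_append]
    exact List.Perm.append_left _ (List.perm_middle (l₁ := u) (a := b)).symm)
  refine Dominated.trans ?_ h2
  simpa using h1

/-- The rows with the numbers `d + n - 1, …, d`, one after the other. -/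
def rowsWord (T : ℕ → List ℕ) : ℕ → ℕ → List ℕ
  | _, 0 => []
  | d, n + 1 => rowsWord T (d + 1) n ++ T d

theorem mem_rowsWord {T : ℕ → List ℕ} {d n x : ℕ} :
    x ∈ rowsWord T d n ↔ ∃ i, d ≤ i ∧ i < d + n ∧ x ∈ T i := by
  induction n generalizing d with
  | zero => simp only [rowsWord, List.not_mem_nil, false_iff]; rintro ⟨i, h1, h2, _⟩; omega
  | succ n ih =>
    simp only [rowsWord, List.mem_append, ih]
    constructor
    · rintro (⟨i, h1, h2, h3⟩ | h)
      · exact ⟨i, by omega, by omega, h3⟩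
      · exact ⟨d, le_rfl, by omega, h⟩
    · rintro ⟨i, h1, h2, h3⟩
      rcases eq_or_lt_of_le h1 with rfl | h
      · exact Or.inr h3
      · exact Or.inl ⟨i, h, by omega, h3⟩

theorem rowsWord_congr {T T' : ℕ → List ℕ} {d n : ℕ} (h : ∀ i, d ≤ i → T i = T' i) :
    rowsWord T d n = rowsWord T' d n := by
  induction n generalizing d with
  | zero => rfl
  | succ n ih => rw [rowsWord, rowsWord, ih (fun i hi => h i (by omega)), h d le_rfl]

/-- `T'` arises from `T` by the insertion of `a 0`; `a (i + 1)` is bumped from row `i`,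
for `i < m`, and the insertion ends in row `m`. -/
structure IsInsertion (T T' : ℕ → List ℕ) (m : ℕ) (a : ℕ → ℕ) : Prop where
  bump : ∀ i < m, ∃ u v, T i = u ++ a (i + 1) :: v ∧ T' i = u ++ a i :: v ∧ a i < a (i + 1) ∧
    ∀ x ∈ u, x < a i
  last : T' m = T m ++ [a m]
  last_lt : ∀ x ∈ T m, x < a m
  above : ∀ i, m < i → T' i = T i

/-- The suffix `q` makes the induction work: the new row `d` joins the suffix while the rows above
are treated, which releases `a (d + 1)` right in front of it. Then `Dominated.row_insert` restores
the old row `d` and releases `a d`. -/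
theorem IsInsertion.dominated {T T' : ℕ → List ℕ} {m : ℕ} {a : ℕ → ℕ} (h : IsInsertion T T' m a)
    (hT : ∀ i, (T i).SortedLT) {d n : ℕ} (q : List ℕ) (hd : d ≤ m) (hn : m < d + n)
    (hnd : (rowsWord T d n ++ a d :: q).Nodup) :
    Dominated (rowsWord T' d n ++ q) (rowsWord T d n ++ a d :: q) := by
  induction n generalizing d q with
  | zero => omega
  | succ n ih =>
    rcases eq_or_lt_of_le hd with rfl | hd
    · rw [rowsWord, rowsWord, rowsWord_congr (T := T') (T' := T) (fun i hi => h.above i hi), h.last]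
      simpa using Dominated.refl _
    · obtain ⟨u, v, h1, h2, h3, h4⟩ := h.bump d hd
      simp only [rowsWord, h1, h2] at hnd ⊢
      have hs := List.sortedLT_iff_pairwise.1 (hT d)
      rw [h1, List.pairwise_append] at hs
      have hperm : List.Perm (rowsWord T (d + 1) n ++ (u ++ a (d + 1) :: v) ++ a d :: q)
          (rowsWord T (d + 1) n ++ a (d + 1) :: (u ++ a d :: v ++ q)) := by
        simp only [List.append_assoc, List.cons_append]
        refine List.Perm.append_left _ (List.perm_middle.trans (List.Perm.cons _ ?_))
        exact List.Perm.append_left _ List.perm_middle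
      have hnd' := hperm.nodup_iff.1 hnd
      have := ih (d := d + 1) (u ++ a d :: v ++ q) hd (by omega) hnd'
      rw [← List.append_assoc] at this
      refine this.trans ?_
      have := Dominated.row_insert (p := rowsWord T (d + 1) n) (q := q) (u := u) (v := v) h3
        (by
          rw [List.sortedLT_iff_pairwise, List.pairwise_append]
          exact ⟨hs.1, by simp, by simpa using h4⟩)
        (List.sortedLT_iff_pairwise.2 hs.2.1) (by simpa using hnd')
      simpa using this

/-! ### Adding squares and the local rules -/

theorem ext_rowLen {mu nu : YoungDiagram} (h : ∀ i, mu.rowLen i = nu.rowLen i) : mu = nu := by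
  refine YoungDiagram.ext ?_
  ext ⟨i, j⟩
  rw [YoungDiagram.mem_cells, YoungDiagram.mem_cells, YoungDiagram.mem_iff_lt_rowLen,
    YoungDiagram.mem_iff_lt_rowLen, h]

theorem rowLen_sup (mu nu : YoungDiagram) (i : ℕ) :
    (mu ⊔ nu).rowLen i = max (mu.rowLen i) (nu.rowLen i) := by
  refine eq_of_forall_lt_iff fun j => ?_
  rw [← YoungDiagram.mem_iff_lt_rowLen, YoungDiagram.mem_sup, lt_max_iff,
    YoungDiagram.mem_iff_lt_rowLen, YoungDiagram.mem_iff_lt_rowLen]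

theorem rowLen_bot (i : ℕ) : (⊥ : YoungDiagram).rowLen i = 0 := by
  by_contra h
  exact YoungDiagram.notMem_bot _ (YoungDiagram.mem_iff_lt_rowLen.2 (Nat.pos_of_ne_zero h))

/-- `mu` is `rho` with a square added to row `i`. -/
def AddsBox (i : ℕ) (rho mu : YoungDiagram) : Prop :=
  ∀ j, mu.rowLen j = rho.rowLen j + if j = i then 1 else 0

theorem AddsBox.ne {i : ℕ} {rho mu : YoungDiagram} (h : AddsBox i rho mu) : rho ≠ mu := by
  rintro rfl
  have := h i
  simp at this

theorem AddsBox.unique {i : ℕ} {rho mu nu : YoungDiagram} (h : AddsBox i rho mu)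
    (h' : AddsBox i rho nu) : mu = nu :=
  ext_rowLen fun j => by rw [h j, h' j]

theorem AddsBox.index_eq {i j : ℕ} {rho mu : YoungDiagram} (h : AddsBox i rho mu)
    (h' : AddsBox j rho mu) : i = j := by
  by_contra hij
  have h1 := h i
  have h2 := h' i
  simp only [if_true, if_neg hij] at h1 h2
  omega

theorem AddsBox.card {i : ℕ} {rho mu : YoungDiagram} (h : AddsBox i rho mu) :
    mu.card = rho.card + 1 := by
  have : mu.cells = insert (i, rho.rowLen i) rho.cells := by
    ext ⟨a, b⟩
    have := h a
    simp only [Finset.mem_insert, YoungDiagram.mem_cells, YoungDiagram.mem_iff_lt_rowLen,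
      Prod.mk.injEq]
    split_ifs at this with hai
    · subst hai; omega
    · omega
  rw [YoungDiagram.card, this, Finset.card_insert_of_notMem]
  rw [YoungDiagram.mem_cells, YoungDiagram.mem_iff_lt_rowLen]
  exact lt_irrefl _

theorem addsBox_addSquare {mu : YoungDiagram} {i : ℕ}
    (h : ∀ j < i, mu.rowLen i < mu.rowLen j) : AddsBox i mu (addSquare mu i) := by
  have hl : IsLowerSet (↑(insert (i, mu.rowLen i) mu.cells) : Set (ℕ × ℕ)) := by
    rintro ⟨a, b⟩ ⟨a', b'⟩ hab ha
    obtain ⟨h1, h2⟩ : a' ≤ a ∧ b' ≤ b := hab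
    simp only [Finset.coe_insert, Set.mem_insert_iff, Prod.mk.injEq, Finset.mem_coe,
      YoungDiagram.mem_cells, YoungDiagram.mem_iff_lt_rowLen] at ha ⊢
    rcases ha with ⟨rfl, rfl⟩ | ha
    · rcases eq_or_lt_of_le h1 with rfl | h1
      · omega
      · have := h _ h1
        omega
    · have := mu.rowLen_anti a' a h1
      omega
  intro j
  refine eq_of_forall_lt_iff fun b => ?_
  rw [← YoungDiagram.mem_iff_lt_rowLen, addSquare, dif_pos hl, ← YoungDiagram.mem_cells]
  simp only [Finset.mem_insert, Prod.mk.injEq, YoungDiagram.mem_cells,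
    YoungDiagram.mem_iff_lt_rowLen]
  split_ifs with hij
  · subst hij; omega
  · omega

/-- The forward rule if `nu` has one more square than `rho`. -/
theorem forwardRule_of_addsBox {cross : Prop} {m : ℕ} {rho mu nu : YoungDiagram}
    (hnu : AddsBox m rho nu) (hmu : rho = mu ∨ ∃ i, AddsBox i rho mu) :
    (rho = mu ∧ forwardRule cross rho mu nu = nu) ∨
    ∃ i, AddsBox i rho mu ∧
      ((i ≠ m ∧ AddsBox i nu (forwardRule cross rho mu nu) ∧
        AddsBox m mu (forwardRule cross rho mu nu)) ∨
      (i = m ∧ AddsBox (m + 1) nu (forwardRule cross rho mu nu) ∧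
        AddsBox (m + 1) mu (forwardRule cross rho mu nu))) := by
  rcases hmu with rfl | ⟨i, hmu⟩
  · left
    simp [forwardRule, hnu.ne]
  · refine Or.inr ⟨i, hmu, ?_⟩
    by_cases him : i = m
    · subst him
      obtain rfl := hmu.unique hnu
      refine Or.inr ⟨rfl, ?_⟩
      have hS : {k | mu.rowLen k ≠ rho.rowLen k} = {i} := by
        ext k
        have := hmu k
        simp only [Set.mem_ofPred_eq, Set.mem_singleton_iff]
        split_ifs at this with h
        · simp only [h, iff_true]; subst h; omega
        · simp [this, h]
      have : forwardRule cross rho mu mu = addSquare mu (i + 1) := by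
        simp [forwardRule, hmu.ne, hS]
      rw [this, and_self]
      -- Row `i` of `mu` has just grown, so it is strictly longer than row `i + 1` and a square fits
      -- there.
      refine addsBox_addSquare fun j hj => ?_
      have h1 := hmu (i + 1)
      have h2 := hmu i
      have h3 := mu.rowLen_anti j i (by omega)
      have h4 := rho.rowLen_anti i (i + 1) (by omega)
      simp at h1 h2
      omega
    · refine Or.inl ⟨him, ?_⟩
      have hne : mu ≠ nu := by
        rintro rfl
        exact him (hmu.index_eq hnu)
      have : forwardRule cross rho mu nu = mu ⊔ nu := by
        simp [forwardRule, hmu.ne, hnu.ne, hne]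
      rw [this]
      constructor <;> intro j <;> rw [rowLen_sup, hmu j, hnu j] <;> split_ifs <;> omega

/-! ### Growth of labels along a line as row insertion -/

variable {X : ℕ → ℕ → Prop}

theorem growthLabel_zero_left (X : ℕ → ℕ → Prop) (s : ℕ) : growthLabel X 0 s = ⊥ := by
  rw [growthLabel]

theorem growthLabel_zero_right (X : ℕ → ℕ → Prop) (r : ℕ) : growthLabel X r 0 = ⊥ := by
  cases r <;> rw [growthLabel]

theorem growthLabel_succ (X : ℕ → ℕ → Prop) (r s : ℕ) : growthLabel X (r + 1) (s + 1) =
    forwardRule (X r s) (growthLabel X r s) (growthLabel X r (s + 1))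
      (growthLabel X (r + 1) s) := by
  rw [growthLabel]

theorem growthLabel_succ_left {r s : ℕ} (h : ∀ j < s, ¬ X r j) :
    growthLabel X (r + 1) s = growthLabel X r s := by
  induction s with
  | zero => rw [growthLabel_zero_right, growthLabel_zero_right]
  | succ s ih =>
    rw [growthLabel_succ, ih fun j hj => h j (by omega), forwardRule]
    have := h s (by omega)
    split_ifs <;> simp_all

theorem growthLabel_succ_right {r s : ℕ} (h : ∀ i < r, ¬ X i s) :
    growthLabel X r (s + 1) = growthLabel X r s := by
  induction r with
  | zero => rw [growthLabel_zero_left, growthLabel_zero_left]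
  | succ r ih =>
    rw [growthLabel_succ, ih fun j hj => h j (by omega), forwardRule]
    have := h r (by omega)
    split_ifs <;> simp_all

/-- The cross is alone in its row and its column, so the other three labels of its cell coincide. -/
theorem growthLabel_of_cross (hrow : ∀ i j j', X i j → X i j' → j = j')
    (hcol : ∀ i i' j, X i j → X i' j → i = i') {r c : ℕ} (h : X r c) :
    AddsBox 0 (growthLabel X r c) (growthLabel X (r + 1) (c + 1)) := by
  rw [growthLabel_succ, growthLabel_succ_left (fun j hj hj' => hj.ne (hrow _ _ _ hj' h)),
    growthLabel_succ_right (fun i hi hi' => hi.ne (hcol _ _ _ hi' h))]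
  simp only [forwardRule, and_self, if_true, h]
  exact addsBox_addSquare (by simp)

/-- Row `i` of the insertion tableau with the labels `growthLabel X r 0, …, growthLabel X r s`. -/
noncomputable def tableauRow (X : ℕ → ℕ → Prop) (r s i : ℕ) : List ℕ :=
  (List.range s).filter fun j => (growthLabel X r j).rowLen i < (growthLabel X r (j + 1)).rowLen i

theorem mem_tableauRow {r s i j : ℕ} : j ∈ tableauRow X r s i ↔
    j < s ∧ (growthLabel X r j).rowLen i < (growthLabel X r (j + 1)).rowLen i := by
  simp [tableauRow]

theorem sortedLT_tableauRow (X : ℕ → ℕ → Prop) (r s i : ℕ) : (tableauRow X r s i).SortedLT :=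
  List.sortedLT_iff_pairwise.2 (List.pairwise_lt_range.sublist List.filter_sublist)

theorem tableauRow_succ_of_eq {r s : ℕ} (h : growthLabel X r s = growthLabel X r (s + 1))
    (i : ℕ) : tableauRow X r (s + 1) i = tableauRow X r s i := by
  simp [tableauRow, List.range_succ, List.filter_append, ← h]

theorem tableauRow_succ_of_addsBox {r s k : ℕ}
    (h : AddsBox k (growthLabel X r s) (growthLabel X r (s + 1))) (i : ℕ) :
    tableauRow X r (s + 1) i = tableauRow X r s i ++ if i = k then [s] else [] := by
  have := h i
  rw [tableauRow, List.range_succ, List.filter_append, ← tableauRow]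
  congr 1
  split_ifs at this ⊢ with hik <;> simp [this]

/-- Neighbouring labels in the row of corners at height `r` differ by at most one square. -/
def HasSteps (X : ℕ → ℕ → Prop) (r : ℕ) : Prop :=
  ∀ s, growthLabel X r s = growthLabel X r (s + 1) ∨
    ∃ i, AddsBox i (growthLabel X r s) (growthLabel X r (s + 1))

/-- The insertion of `c` is followed through the letters below `c + 1 + n`; `m` is the row in which
it ends as far as these letters are concerned, and also the row in which the upper label exceeds the
lower one. -/
theorem exists_isInsertion (hrow : ∀ i j j', X i j → X i j' → j = j')
    (hcol : ∀ i i' j, X i j → X i' j → i = i') {r c : ℕ} (h : X r c) (hr : HasSteps X r)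
    (n : ℕ) : ∃ m a, a 0 = c ∧
      AddsBox m (growthLabel X r (c + 1 + n)) (growthLabel X (r + 1) (c + 1 + n)) ∧
      IsInsertion (tableauRow X r (c + 1 + n)) (tableauRow X (r + 1) (c + 1 + n)) m a := by
  induction n with
  | zero =>
    have h1 := growthLabel_of_cross hrow hcol h
    have h2 := growthLabel_succ_right (s := c) (fun i hi hi' => hi.ne (hcol _ _ _ hi' h))
    have h3 : ∀ j ≤ c, growthLabel X (r + 1) j = growthLabel X r j := fun j hj =>
      growthLabel_succ_left fun j' hj' hX => absurd (hrow _ _ _ hX h) (by omega)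
    have h4 : ∀ i, tableauRow X (r + 1) c i = tableauRow X r c i := by
      intro i
      refine List.filter_congr fun j hj => ?_
      have := List.mem_range.1 hj
      rw [h3 j (by omega), h3 (j + 1) (by omega)]
    have h5 := tableauRow_succ_of_addsBox (X := X) (r := r + 1) (s := c) (k := 0)
      (by rw [h3 c le_rfl]; exact h1)
    have h6 := tableauRow_succ_of_eq h2.symm
    refine ⟨0, fun _ => c, rfl, ?_, ?_, ?_, ?_, ?_⟩
    · rw [Nat.add_zero, h2]; exact h1
    · simp
    · rw [Nat.add_zero, h5, h6, h4]; simp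
    · intro x hx
      rw [Nat.add_zero, h6] at hx
      exact (mem_tableauRow.1 hx).1
    · intro i hi
      rw [Nat.add_zero, h5, h6, h4, if_neg (by omega), List.append_nil]
  | succ n ih =>
    obtain ⟨m, a, ha, hm, hI⟩ := ih
    rw [← Nat.add_assoc]
    generalize hs : c + 1 + n = s at *
    have hrule := forwardRule_of_addsBox (cross := X r s) hm (hr s)
    rw [← growthLabel_succ] at hrule
    rcases hrule with ⟨h1, h2⟩ | ⟨i, h1, ⟨him, h2, h3⟩ | ⟨rfl, h2, h3⟩⟩
    -- No row contains the letter `s`, so nothing changes.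
    · have e1 := tableauRow_succ_of_eq h1
      have e2 := tableauRow_succ_of_eq h2.symm
      refine ⟨m, a, ha, by rwa [← h1, h2], ?_⟩
      rw [funext e1, funext e2]
      exact hI
    -- The letter `s` joins a row other than `m`, in the old and in the new tableau alike.
    · have e1 := tableauRow_succ_of_addsBox h1
      have e2 := tableauRow_succ_of_addsBox h2
      refine ⟨m, a, ha, h3, fun j hj => ?_, ?_, ?_, fun j hj => ?_⟩
      · obtain ⟨u, v, p1, p2, p3, p4⟩ := hI.bump j hj
        refine ⟨u, v ++ if j = i then [s] else [], ?_, ?_, p3, p4⟩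
        · rw [e1, p1]; simp
        · rw [e2, p2]; simp
      · rw [e1, e2, hI.last, if_neg him.symm]; simp
      · intro x hx
        rw [e1, if_neg him.symm, List.append_nil] at hx
        exact hI.last_lt x hx
      · rw [e1, e2, hI.above j hj]
    -- The letter `s` ends the old row in which the insertion has ended so far. It exceeds `a i`,
    -- which thus bumps it, and it becomes the last letter of the next row.
    · have e1 := tableauRow_succ_of_addsBox h1
      have e2 := tableauRow_succ_of_addsBox h2
      have ha' : a i < s := by
        have : a i ∈ tableauRow X (r + 1) s i := by rw [hI.last]; simp
        exact (mem_tableauRow.1 this).1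
      refine ⟨i + 1, Function.update a (i + 1) s, by simpa using ha, h3, fun j hj => ?_, ?_, ?_,
        fun j hj => ?_⟩
      · rcases Nat.lt_succ_iff_lt_or_eq.1 hj with hj' | rfl
        · obtain ⟨u, v, p1, p2, p3, p4⟩ := hI.bump j hj'
          refine ⟨u, v, ?_, ?_, ?_, ?_⟩
          · rw [e1, p1, if_neg (by omega), Function.update_of_ne (by omega)]; simp
          · rw [e2, p2, if_neg (by omega), Function.update_of_ne (by omega)]; simp
          · rw [Function.update_of_ne (by omega), Function.update_of_ne (by omega)]; exact p3
          · rw [Function.update_of_ne (by omega)]; exact p4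
        · refine ⟨tableauRow X r s j, [], ?_, ?_, ?_, ?_⟩
          · rw [e1, if_pos rfl]; simp
          · rw [e2, hI.last, if_neg (by omega), Function.update_of_ne (by omega)]; simp
          · simpa using ha'
          · rw [Function.update_of_ne (by omega)]; exact hI.last_lt
      · rw [e1, e2, if_pos rfl, if_neg (by omega), hI.above _ (Nat.lt_succ_self _)]; simp
      · intro x hx
        rw [e1, if_neg (by omega), List.append_nil] at hx
        simpa using (mem_tableauRow.1 hx).1
      · rw [e1, e2, hI.above j (by omega), if_neg (by omega), if_neg (by omega)]

theorem hasSteps (hrow : ∀ i j j', X i j → X i j' → j = j')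
    (hcol : ∀ i i' j, X i j → X i' j → i = i') (r : ℕ) : HasSteps X r := by
  induction r with
  | zero => intro s; left; rw [growthLabel_zero_left, growthLabel_zero_left]
  | succ r ih =>
    intro s
    by_cases hc : ∃ c ≤ s, X r c
    · obtain ⟨c, hcs, hc⟩ := hc
      rcases eq_or_lt_of_le hcs with rfl | hcs
      · right
        refine ⟨0, ?_⟩
        rw [growthLabel_succ_left fun j hj hX => absurd (hrow _ _ _ hX hc) (by omega)]
        exact growthLabel_of_cross hrow hcol hc
      · obtain ⟨n, rfl⟩ := Nat.exists_eq_add_of_le (Nat.succ_le_of_lt hcs)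
        obtain ⟨m, a, -, hm, -⟩ := exists_isInsertion hrow hcol hc ih n
        rw [Nat.succ_eq_add_one]
        have hrule := forwardRule_of_addsBox (cross := X r (c + 1 + n)) hm (ih _)
        rw [← growthLabel_succ] at hrule
        rcases hrule with ⟨h1, h2⟩ | ⟨i, h1, ⟨him, h2, h3⟩ | ⟨rfl, h2, h3⟩⟩
        · exact Or.inl h2.symm
        · exact Or.inr ⟨_, h2⟩
        · exact Or.inr ⟨_, h2⟩
    · push Not at hc
      rw [growthLabel_succ_left fun j hj => hc j hj.le,
        growthLabel_succ_left fun j hj => hc j (by omega)]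
      exact ih s

/-! ### The word of the crosses and the tableau -/

open Classical in
/-- The columns of the crosses in the first `r` rows and `s` columns, row by row. -/
noncomputable def crossWord (X : ℕ → ℕ → Prop) : ℕ → ℕ → List ℕ
  | 0, _ => []
  | r + 1, s => crossWord X r s ++ (List.range s).filter (X r ·)

theorem mem_crossWord {r s j : ℕ} : j ∈ crossWord X r s ↔ j < s ∧ ∃ i < r, X i j := by
  induction r with
  | zero => simp [crossWord]
  | succ r ih =>
    simp only [crossWord, List.mem_append, ih, List.mem_filter, List.mem_range, decide_eq_true_eq]
    constructor
    · rintro (⟨h, i, hi, hX⟩ | ⟨h, hX⟩)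
      · exact ⟨h, i, by omega, hX⟩
      · exact ⟨h, r, by omega, hX⟩
    · rintro ⟨h, i, hi, hX⟩
      rcases Nat.lt_succ_iff_lt_or_eq.1 hi with hi | rfl
      · exact Or.inl ⟨h, i, hi, hX⟩
      · exact Or.inr ⟨h, hX⟩

theorem rel_of_pairwise_crossWord {R : ℕ → ℕ → Prop} {r s : ℕ}
    (h : (crossWord X r s).Pairwise R) {i i' j j' : ℕ} (hii : i < i') (hi' : i' < r)
    (hj : j < s) (hj' : j' < s) (hX : X i j) (hX' : X i' j') : R j j' := by
  induction r with
  | zero => omega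
  | succ r ih =>
    rw [crossWord, List.pairwise_append] at h
    rcases Nat.lt_succ_iff_lt_or_eq.1 hi' with hi' | rfl
    · exact ih h.1 hi'
    · exact h.2.2 j (mem_crossWord.2 ⟨hj, i, hii, hX⟩) j' (by simp [hj', hX'])

theorem crossWord_succ_of_cross (hrow : ∀ i j j', X i j → X i j' → j = j') {r s c : ℕ}
    (hc : c < s) (hX : X r c) : crossWord X (r + 1) s = crossWord X r s ++ [c] := by
  classical
  rw [crossWord]
  congr 1
  have : (List.range s).filter (X r ·) = (List.range s).filter (· == c) := by
    refine List.filter_congr fun j _ => ?_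
    rw [Bool.eq_iff_iff]
    simp only [decide_eq_true_eq, beq_iff_eq]
    exact ⟨fun h => hrow _ _ _ h hX, fun h => h ▸ hX⟩
  have h2 : (List.range s).filter (X r ·) = [c] := by
    rw [this, List.filter_beq, List.count_eq_one_of_mem List.nodup_range (by simpa using hc)]
    rfl
  convert h2

theorem crossWord_succ_of_not {r s : ℕ} (h : ∀ j < s, ¬ X r j) :
    crossWord X (r + 1) s = crossWord X r s := by
  rw [crossWord, List.filter_eq_nil_iff.2 (by simpa using h), List.append_nil]

theorem length_crossWord (hrow : ∀ i j j', X i j → X i j' → j = j')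
    (hcol : ∀ i i' j, X i j → X i' j → i = i') (r s : ℕ) :
    (crossWord X r s).length = (growthLabel X r s).card := by
  induction r with
  | zero => rw [growthLabel_zero_left]; rfl
  | succ r ih =>
    by_cases hc : ∃ c < s, X r c
    · obtain ⟨c, hcs, hc⟩ := hc
      obtain ⟨n, rfl⟩ := Nat.exists_eq_add_of_le (Nat.succ_le_of_lt hcs)
      obtain ⟨m, a, -, hm, -⟩ := exists_isInsertion hrow hcol hc (hasSteps hrow hcol r) n
      rw [crossWord_succ_of_cross hrow hcs hc, List.length_append, ih]
      exact hm.card.symm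
    · push Not at hc
      rw [crossWord_succ_of_not hc, growthLabel_succ_left hc, ih]

theorem index_eq_of_mem_tableauRow (hrow : ∀ i j j', X i j → X i j' → j = j')
    (hcol : ∀ i i' j, X i j → X i' j → i = i') {r s i i' j : ℕ}
    (h : j ∈ tableauRow X r s i) (h' : j ∈ tableauRow X r s i') : i = i' := by
  have h1 := (mem_tableauRow.1 h).2
  have h2 := (mem_tableauRow.1 h').2
  rcases hasSteps hrow hcol r j with e | ⟨k, hk⟩
  · rw [e] at h1; omega
  · have h3 := hk i
    have h4 := hk i'
    split_ifs at h3 h4 <;> omega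

theorem pairwise_rowsWord {R : ℕ → ℕ → Prop} {T : ℕ → List ℕ} (hT : ∀ i, (T i).Pairwise R)
    (hTT : ∀ i i' x y, i < i' → x ∈ T i' → y ∈ T i → R x y) (d n : ℕ) :
    (rowsWord T d n).Pairwise R := by
  induction n generalizing d with
  | zero => exact List.Pairwise.nil
  | succ n ih =>
    rw [rowsWord, List.pairwise_append]
    refine ⟨ih _, hT d, fun x hx y hy => ?_⟩
    obtain ⟨i, hi, -, hx⟩ := mem_rowsWord.1 hx
    exact hTT d i x y hi hx hy

/-- The suffix `q` stands for the crosses in later rows: undoing the last insertion puts `c` in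
front of `q`, and the induction hypothesis applies to `c :: q`. The bound `N₀` ensures that the rows
taken include every row reached by an insertion. -/
theorem exists_dominated_crossWord (hrow : ∀ i j j', X i j → X i j' → j = j')
    (hcol : ∀ i i' j, X i j → X i' j → i = i') (r s : ℕ) :
    ∃ N₀, ∀ N ≥ N₀, ∀ q : List ℕ, q.Nodup → (∀ j ∈ q, ∀ i < r, ¬ X i j) →
      Dominated (rowsWord (tableauRow X r s) 0 N ++ q) (crossWord X r s ++ q) := by
  induction r with
  | zero =>
    refine ⟨0, fun N _ q _ _ => ?_⟩
    have : rowsWord (tableauRow X 0 s) 0 N = [] := by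
      rw [List.eq_nil_iff_forall_not_mem]
      intro x hx
      obtain ⟨i, -, -, hx⟩ := mem_rowsWord.1 hx
      have := (mem_tableauRow.1 hx).2
      rw [growthLabel_zero_left, growthLabel_zero_left] at this
      omega
    rw [this]
    exact Dominated.refl _
  | succ r ih =>
    obtain ⟨N₀, hN₀⟩ := ih
    by_cases hc : ∃ c < s, X r c
    · obtain ⟨c, hcs, hc⟩ := hc
      obtain ⟨n, hn⟩ := Nat.exists_eq_add_of_le (Nat.succ_le_of_lt hcs)
      obtain ⟨m, a, ha, hm, hI⟩ := exists_isInsertion hrow hcol hc (hasSteps hrow hcol r) n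
      rw [← Nat.succ_eq_add_one, ← hn] at hm hI
      refine ⟨max N₀ (m + 1), fun N hN q hq hqX => ?_⟩
      have hcq : (c :: q).Nodup := List.nodup_cons.2 ⟨fun h => hqX c h r (by omega) hc, hq⟩
      have hcqX : ∀ j ∈ c :: q, ∀ i < r, ¬ X i j := by
        rintro j hj i hi hX
        rcases List.mem_cons.1 hj with rfl | hj
        · exact hi.ne (hcol _ _ _ hX hc)
        · exact hqX j hj i (by omega) hX
      -- Letters of the tableau are columns that already contain a cross, so none of them occurs in
      -- `c :: q`.
      have hnd : (rowsWord (tableauRow X r s) 0 N ++ c :: q).Nodup := by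
        rw [List.nodup_append]
        refine ⟨pairwise_rowsWord (fun i => (sortedLT_tableauRow X r s i).nodup) ?_ 0 N,
          hcq, ?_⟩
        · rintro i i' x y hii hx hy rfl
          exact hii.ne (index_eq_of_mem_tableauRow hrow hcol hy hx)
        · rintro x hx _ hy rfl
          obtain ⟨i, -, -, hx⟩ := mem_rowsWord.1 hx
          have := (mem_tableauRow.1 hx).2
          rw [growthLabel_succ_right (hcqX x hy)] at this
          omega
      have h1 := hI.dominated (sortedLT_tableauRow X r s) (d := 0) (n := N) q (by omega)
        (by omega) (by rwa [ha])
      rw [ha] at h1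
      rw [crossWord_succ_of_cross hrow hcs hc, List.append_assoc]
      exact h1.trans (hN₀ N (by omega) _ hcq hcqX)
    · push Not at hc
      rw [crossWord_succ_of_not hc]
      refine ⟨N₀, fun N hN q hq hqX => ?_⟩
      have : tableauRow X (r + 1) s = tableauRow X r s := by
        funext i
        refine List.filter_congr fun j hj => ?_
        have := List.mem_range.1 hj
        rw [growthLabel_succ_left fun j' hj' => hc j' (by omega),
          growthLabel_succ_left fun j' hj' => hc j' (by omega)]
      rw [this]
      exact hN₀ N hN q hq fun j hj i hi => hqX j hj i (by omega)

/-! ### Lower bounds from the rows and columns of the tableau -/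

theorem card_filter_fst_lt (mu : YoungDiagram) (k : ℕ) :
    (mu.cells.filter fun p => p.1 < k).card = ∑ i ∈ Finset.range k, mu.rowLen i := by
  rw [Finset.card_eq_sum_card_fiberwise (f := Prod.fst) (t := Finset.range k)
    (fun p hp => by simpa using (Finset.mem_filter.1 hp).2)]
  refine Finset.sum_congr rfl fun i hi => ?_
  rw [YoungDiagram.rowLen_eq_card]
  congr 1
  ext p
  simp only [Finset.mem_filter, YoungDiagram.mem_cells, YoungDiagram.mem_row_iff]
  have := Finset.mem_range.1 hi
  constructor
  · rintro ⟨⟨h1, -⟩, h2⟩; exact ⟨h1, h2⟩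
  · rintro ⟨h1, h2⟩; exact ⟨⟨h1, by omega⟩, h2⟩

theorem card_filter_snd_lt (mu : YoungDiagram) (k : ℕ) :
    (mu.cells.filter fun p => p.2 < k).card = ∑ j ∈ Finset.range k, mu.colLen j := by
  rw [Finset.card_eq_sum_card_fiberwise (f := Prod.snd) (t := Finset.range k)
    (fun p hp => by simpa using (Finset.mem_filter.1 hp).2)]
  refine Finset.sum_congr rfl fun i hi => ?_
  rw [YoungDiagram.colLen_eq_card]
  congr 1
  ext p
  simp only [Finset.mem_filter, YoungDiagram.mem_cells, YoungDiagram.mem_col_iff]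
  have := Finset.mem_range.1 hi
  constructor
  · rintro ⟨⟨h1, -⟩, h2⟩; exact ⟨h1, h2⟩
  · rintro ⟨h1, h2⟩; exact ⟨⟨h1, by omega⟩, h2⟩

theorem rowLen_growthLabel_mono (hrow : ∀ i j j', X i j → X i j' → j = j')
    (hcol : ∀ i i' j, X i j → X i' j → i = i') (r i : ℕ) :
    Monotone fun s => (growthLabel X r s).rowLen i := by
  refine monotone_nat_of_le_succ fun s => ?_
  rcases hasSteps hrow hcol r s with e | ⟨k, hk⟩
  · rw [e]
  · rw [hk i]; omega

theorem exists_mem_tableauRow (hrow : ∀ i j j', X i j → X i j' → j = j')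
    (hcol : ∀ i i' j, X i j → X i' j → i = i') {r s i p : ℕ}
    (h : p < (growthLabel X r s).rowLen i) :
    ∃ j ∈ tableauRow X r s i, (growthLabel X r j).rowLen i = p := by
  induction s with
  | zero => rw [growthLabel_zero_right, rowLen_bot] at h; omega
  | succ s ih =>
    by_cases hp : p < (growthLabel X r s).rowLen i
    · obtain ⟨j, hj, hjp⟩ := ih hp
      rw [mem_tableauRow] at hj
      exact ⟨j, mem_tableauRow.2 ⟨by omega, hj.2⟩, hjp⟩
    · refine ⟨s, mem_tableauRow.2 ⟨by omega, by omega⟩, ?_⟩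
      rcases hasSteps hrow hcol r s with e | ⟨k, hk⟩
      · rw [← e] at h; omega
      · have := hk i
        split_ifs at this <;> omega

/-- The lower bounds in Greene's theorem for the crosses below and to the left of a corner. -/
theorem hasColoring_crossWord (hrow : ∀ i j j', X i j → X i j' → j = j')
    (hcol : ∀ i i' j, X i j → X i' j → i = i') (r s k : ℕ) :
    HasColoring (crossWord X r s) k (∑ i ∈ Finset.range k, (growthLabel X r s).rowLen i) ∧
    HasColoring (crossWord X r s).reverse k
      (∑ j ∈ Finset.range k, (growthLabel X r s).colLen j) := by
  classical
  obtain ⟨N₀, hN₀⟩ := exists_dominated_crossWord hrow hcol r s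
  obtain ⟨N, hN, hNrow⟩ : ∃ N ≥ N₀, ∀ i, (growthLabel X r s).rowLen i ≠ 0 → i < N := by
    refine ⟨max N₀ ((growthLabel X r s).colLen 0), le_max_left _ _, fun i hi => ?_⟩
    exact lt_max_of_lt_right (YoungDiagram.mem_iff_lt_colLen.1
      (YoungDiagram.mem_iff_lt_rowLen.2 (Nat.pos_of_ne_zero hi)))
  have hdom := hN₀ N hN [] List.nodup_nil (by simp)
  rw [List.append_nil, List.append_nil] at hdom
  set lam := growthLabel X r s with hlam
  -- `R` and `C` give the row and the column of a letter in the tableau: `C j` is the length of its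
  -- row just before `j` is appended.
  obtain ⟨R, hR⟩ : ∃ R : ℕ → ℕ, ∀ i j, j ∈ tableauRow X r s i → R j = i := by
    refine ⟨fun j => if h : ∃ i, j ∈ tableauRow X r s i then h.choose else 0, fun i j hj => ?_⟩
    have h : ∃ i, j ∈ tableauRow X r s i := ⟨i, hj⟩
    simp only [dif_pos h]
    exact index_eq_of_mem_tableauRow hrow hcol h.choose_spec hj
  set C : ℕ → ℕ := fun j => (growthLabel X r j).rowLen (R j) with hC
  set w := rowsWord (tableauRow X r s) 0 N with hw
  have hwR : ∀ j ∈ w, j ∈ tableauRow X r s (R j) := by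
    intro j hj
    obtain ⟨i, -, -, hi⟩ := mem_rowsWord.1 hj
    rwa [hR i j hi]
  have hcard : ∀ (P : ℕ × ℕ → Prop) [DecidablePred P], (lam.cells.filter P).card ≤
      (w.toFinset.filter fun j => P (R j, C j)).card := by
    intro P _
    refine Finset.card_le_card_of_surjOn (fun j => (R j, C j)) ?_
    rintro ⟨i, p⟩ hip
    simp only [Finset.coe_filter, YoungDiagram.mem_cells, Set.mem_ofPred_eq] at hip
    obtain ⟨hip, hP⟩ := hip
    rw [YoungDiagram.mem_iff_lt_rowLen] at hip
    obtain ⟨j, hj, hjp⟩ := exists_mem_tableauRow hrow hcol hip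
    have hRj := hR i j hj
    have hCj : C j = p := by simp only [hC, hRj, hjp]
    refine ⟨j, ?_, by simp only [hRj, hCj]⟩
    simp only [Finset.coe_filter, List.mem_toFinset, Set.mem_ofPred_eq, hRj, hCj]
    exact ⟨mem_rowsWord.2 ⟨i, by omega, by have := hNrow i (by omega); omega, hj⟩, hP⟩
  have hlt : ∀ i, (tableauRow X r s i).Pairwise (· < ·) := fun i =>
    List.sortedLT_iff_pairwise.1 (sortedLT_tableauRow X r s i)
  constructor
  · refine (hdom k _).1 ⟨w.toFinset.filter fun j => R j < k, R, Finset.filter_subset _ _, ?_,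
      fun x hx => (Finset.mem_filter.1 hx).2, ?_⟩
    · rw [← card_filter_fst_lt]
      exact hcard fun p => p.1 < k
    · refine pairwise_rowsWord (fun i => (hlt i).imp fun h _ _ _ => h) ?_ 0 N
      intro i i' x y hii hx hy _ _ h
      rw [hR _ _ hx, hR _ _ hy] at h
      omega
  · refine (hdom k _).2 ⟨w.toFinset.filter fun j => C j < k, C, ?_, ?_,
      fun x hx => (Finset.mem_filter.1 hx).2, ?_⟩
    · rw [List.toFinset_reverse]; exact Finset.filter_subset _ _
    · rw [← card_filter_snd_lt]
      exact hcard fun p => p.2 < k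
    · rw [List.pairwise_reverse]
      have hCx : ∀ i j, j ∈ tableauRow X r s i → C j = (growthLabel X r j).rowLen i :=
        fun i j hj => by simp only [hC, hR i j hj]
      refine pairwise_rowsWord (fun i => (hlt i).imp_of_mem ?_) ?_ 0 N
      · intro x y hx hy hxy _ _ h
        rw [hCx i x hx, hCx i y hy] at h
        have h1 := (mem_tableauRow.1 hx).2
        have h2 := rowLen_growthLabel_mono hrow hcol r i (Nat.succ_le_of_lt hxy)
        simp only [Nat.succ_eq_add_one] at h2
        omega
      -- Columns of the tableau increase upwards. If `x`, in the higher row `i'`, came before `y`,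
      -- then row `i` of the label at `x + 1` would be at least as long as row `i'`, hence longer
      -- than `C x = C y`, so position `C y` of row `i` would be filled before `y`.
      · intro i i' x y hii hx hy _ _ h
        rw [hCx i' x hx, hCx i y hy] at h
        by_contra hyx
        have h1 := (mem_tableauRow.1 hx).2
        have hxy : x ≠ y := by
          rintro rfl
          exact hii.ne (index_eq_of_mem_tableauRow hrow hcol hy hx)
        have h2 := rowLen_growthLabel_mono hrow hcol r i (show x + 1 ≤ y by omega)
        have h3 := (growthLabel X r (x + 1)).rowLen_anti i i' hii.le
        simp only at h2
        omega

/-- The first `k` rows and the first `l` columns cover `mu`, and they overlap in a full `k` by `l`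
rectangle. -/
theorem card_add_mul_le (mu : YoungDiagram) {k l : ℕ} (h : ∀ i j, (i, j) ∈ mu → i < k ∨ j < l)
    (h' : ∀ i j, i < k → j < l → (i, j) ∈ mu) :
    mu.card + k * l ≤ ∑ i ∈ Finset.range k, mu.rowLen i + ∑ j ∈ Finset.range l, mu.colLen j := by
  rw [← card_filter_fst_lt, ← card_filter_snd_lt, ← Finset.card_union_add_card_inter]
  refine Nat.add_le_add (Finset.card_le_card ?_) ?_
  · rintro ⟨i, j⟩ hp
    have := h i j hp
    simp only [Finset.mem_union, Finset.mem_filter]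
    tauto
  · rw [← Finset.card_range k, ← Finset.card_range l, ← Finset.card_product, Finset.card_range,
      Finset.card_range]
    refine Finset.card_le_card ?_
    rintro ⟨i, j⟩ hp
    simp only [Finset.mem_product, Finset.mem_range] at hp
    have := h' i j hp.1 hp.2
    simp [hp, this]

/-! ### Relative position of separated crosses -/

namespace Filling

variable {F : YoungDiagram} {f : Filling F}

/-- Cross number `t` of the cell `(i, j)` is in row `x` and column `y`. -/
def IsCross (f : Filling F) (i j t x y : ℕ) : Prop :=
  t < f.entry i j ∧
    x + ((∑ j' ∈ Finset.range j, f.entry i j') + t) + 1 = f.rowStart i + f.rowHeight i ∧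
    y = f.colStart j + (∑ i' ∈ Finset.Ico (i + 1) (F.colLen j), f.entry i' j) + t

theorem sum_range_add_entry_le {i j : ℕ} (h : f.entry i j ≠ 0) :
    (∑ j' ∈ Finset.range j, f.entry i j') + f.entry i j ≤ f.rowHeight i := by
  have hF : (i, j) ∈ F := by
    by_contra hF
    exact h (f.zeros i j hF)
  rw [← Finset.sum_range_succ]
  refine le_trans (Finset.sum_le_sum_of_subset ?_) (le_max_right _ _)
  exact Finset.range_subset_range.2 (YoungDiagram.mem_iff_lt_rowLen.1 hF)

theorem sum_Ico_add_entry {i j : ℕ} (h : f.entry i j ≠ 0) :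
    (∑ i' ∈ Finset.Ico (i + 1) (F.colLen j), f.entry i' j) + f.entry i j =
      ∑ i' ∈ Finset.Ico i (F.colLen j), f.entry i' j := by
  have hF : (i, j) ∈ F := by
    by_contra hF
    exact h (f.zeros i j hF)
  rw [Finset.sum_eq_sum_Ico_succ_bot (YoungDiagram.mem_iff_lt_colLen.1 hF), add_comm]

theorem sum_Ico_le_colWidth (f : Filling F) (i j : ℕ) :
    ∑ i' ∈ Finset.Ico i (F.colLen j), f.entry i' j ≤ f.colWidth j := by
  refine le_trans (Finset.sum_le_sum_of_subset ?_) (le_max_right _ _)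
  intro a ha
  exact Finset.mem_range.2 (Finset.mem_Ico.1 ha).2

theorem rowStart_mono (f : Filling F) : Monotone f.rowStart := fun _ _ h =>
  Finset.sum_le_sum_of_subset (Finset.range_subset_range.2 h)

theorem colStart_mono (f : Filling F) : Monotone f.colStart := fun _ _ h =>
  Finset.sum_le_sum_of_subset (Finset.range_subset_range.2 h)

namespace IsCross

variable {i j t x y i' j' t' x' y' : ℕ}

theorem row_bounds (h : f.IsCross i j t x y) : f.rowStart i ≤ x ∧ x < f.rowStart (i + 1) := by
  obtain ⟨h1, h2, -⟩ := h
  have := sum_range_add_entry_le (f := f) (i := i) (j := j) (by omega)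
  rw [show f.rowStart (i + 1) = f.rowStart i + f.rowHeight i from Finset.sum_range_succ _ _]
  omega

theorem col_bounds (h : f.IsCross i j t x y) : f.colStart j ≤ y ∧ y < f.colStart (j + 1) := by
  obtain ⟨h1, -, h2⟩ := h
  have h3 := sum_Ico_add_entry (f := f) (i := i) (j := j) (by omega)
  have h4 := f.sum_Ico_le_colWidth i j
  rw [show f.colStart (j + 1) = f.colStart j + f.colWidth j from Finset.sum_range_succ _ _]
  omega

theorem row_lt (h : f.IsCross i j t x y) (h' : f.IsCross i' j' t' x' y') (hi : i < i') :
    x < x' :=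
  h.row_bounds.2.trans_le ((f.rowStart_mono hi).trans h'.row_bounds.1)

theorem col_lt (h : f.IsCross i j t x y) (h' : f.IsCross i' j' t' x' y') (hj : j < j') :
    y < y' :=
  h.col_bounds.2.trans_le ((f.colStart_mono hj).trans h'.col_bounds.1)

theorem row_lt_of_same_row (h : f.IsCross i j t x y) (h' : f.IsCross i j' t' x' y')
    (hj : j < j') : x' < x := by
  obtain ⟨h1, h2, -⟩ := h
  obtain ⟨h1', h2', -⟩ := h'
  have h3 : ∑ j ∈ Finset.range (j + 1), f.entry i j ≤ ∑ j ∈ Finset.range j', f.entry i j :=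
    Finset.sum_le_sum_of_subset (Finset.range_subset_range.2 hj)
  rw [Finset.sum_range_succ] at h3
  omega

theorem col_lt_of_same_col (h : f.IsCross i j t x y) (h' : f.IsCross i' j t' x' y')
    (hi : i < i') : y' < y := by
  obtain ⟨h1, -, h2⟩ := h
  obtain ⟨h1', -, h2'⟩ := h'
  have h3 : ∑ a ∈ Finset.Ico i' (F.colLen j), f.entry a j ≤
      ∑ a ∈ Finset.Ico (i + 1) (F.colLen j), f.entry a j :=
    Finset.sum_le_sum_of_subset (Finset.Ico_subset_Ico_left hi)
  have h4 := sum_Ico_add_entry (f := f) (i := i') (j := j) (by omega)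
  omega

theorem row_lt_of_same_cell (h : f.IsCross i j t x y) (h' : f.IsCross i j t' x' y')
    (ht : t < t') : x' < x ∧ y < y' := by
  obtain ⟨h1, h2, h3⟩ := h
  obtain ⟨h1', h2', h3'⟩ := h'
  omega

theorem eq_of_row_eq (h : f.IsCross i j t x y) (h' : f.IsCross i' j' t' x y') :
    i = i' ∧ j = j' ∧ t = t' := by
  obtain rfl : i = i' := by
    rcases lt_trichotomy i i' with hi | hi | hi
    · exact absurd (h.row_lt h' hi) (lt_irrefl _)
    · exact hi
    · exact absurd (h'.row_lt h hi) (lt_irrefl _)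
  obtain rfl : j = j' := by
    rcases lt_trichotomy j j' with hj | hj | hj
    · exact absurd (h.row_lt_of_same_row h' hj) (lt_irrefl _)
    · exact hj
    · exact absurd (h'.row_lt_of_same_row h hj) (lt_irrefl _)
  have h1 := h.2.1
  have h2 := h'.2.1
  exact ⟨rfl, rfl, by omega⟩

theorem eq_of_col_eq (h : f.IsCross i j t x y) (h' : f.IsCross i' j' t' x' y) :
    i = i' ∧ j = j' ∧ t = t' := by
  obtain rfl : j = j' := by
    rcases lt_trichotomy j j' with hj | hj | hj
    · exact absurd (h.col_lt h' hj) (lt_irrefl _)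
    · exact hj
    · exact absurd (h'.col_lt h hj) (lt_irrefl _)
  obtain rfl : i = i' := by
    rcases lt_trichotomy i i' with hi | hi | hi
    · exact absurd (h.col_lt_of_same_col h' hi) (lt_irrefl _)
    · exact hi
    · exact absurd (h'.col_lt_of_same_col h hi) (lt_irrefl _)
  have h1 := h.2.2
  have h2 := h'.2.2
  exact ⟨rfl, rfl, by omega⟩

/-- Crosses in the same row or column of the original shape run from top/left to bottom/right, so an
increasing pair must differ strictly in both original coordinates. -/
theorem cell_lt (h : f.IsCross i j t x y) (h' : f.IsCross i' j' t' x' y') (hx : x < x')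
    (hy : y < y') : i < i' ∧ j < j' := by
  have hi : i ≤ i' := not_lt.1 fun hi => (h'.row_lt h hi).not_gt hx
  have hj : j ≤ j' := not_lt.1 fun hj => (h'.col_lt h hj).not_gt hy
  rcases eq_or_lt_of_le hi with rfl | hi
  · rcases eq_or_lt_of_le hj with rfl | hj
    · rcases lt_trichotomy t t' with ht | rfl | ht
      · exact absurd (h.row_lt_of_same_cell h' ht).1 hx.not_gt
      · have h1 := h.2.1
        have h2 := h'.2.1
        omega
      · exact absurd (h'.row_lt_of_same_cell h ht).2 hy.not_gt
    · exact absurd (h.row_lt_of_same_row h' hj) hx.not_gt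
  · rcases eq_or_lt_of_le hj with rfl | hj
    · exact absurd (h.col_lt_of_same_col h' hi) hy.not_gt
    · exact ⟨hi, hj⟩

theorem cell_le (h : f.IsCross i j t x y) (h' : f.IsCross i' j' t' x' y') (hx : x < x')
    (hy : y' < y) : i ≤ i' ∧ j' ≤ j :=
  ⟨not_lt.1 fun hi => (h'.row_lt h hi).not_gt hx, not_lt.1 fun hj => (h.col_lt h' hj).not_gt hy⟩

theorem row_lt_iff {r : ℕ} (h : f.IsCross i j t x y) : x < f.rowStart r ↔ i < r := by
  constructor
  · intro hx
    by_contra hi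
    have := f.rowStart_mono (not_lt.1 hi)
    have := h.row_bounds
    omega
  · exact fun hi => h.row_bounds.2.trans_le (f.rowStart_mono hi)

theorem col_lt_iff {s : ℕ} (h : f.IsCross i j t x y) : y < f.colStart s ↔ j < s := by
  constructor
  · intro hx
    by_contra hi
    have := f.colStart_mono (not_lt.1 hi)
    have := h.col_bounds
    omega
  · exact fun hi => h.col_bounds.2.trans_le (f.colStart_mono hi)

end IsCross

theorem exists_isCross {i j t : ℕ} (h : t < f.entry i j) : ∃ x y, f.IsCross i j t x y := by
  have := sum_range_add_entry_le (f := f) (i := i) (j := j) (by omega)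
  exact ⟨f.rowStart i + f.rowHeight i - 1 - ((∑ j' ∈ Finset.range j, f.entry i j') + t), _, h,
    by omega, rfl⟩

theorem augmentedCross_iff {x y : ℕ} : f.AugmentedCross x y ↔ ∃ i j t, f.IsCross i j t x y :=
  Iff.rfl

theorem augmentedCross_row (f : Filling F) (x y y' : ℕ) (h : f.AugmentedCross x y)
    (h' : f.AugmentedCross x y') : y = y' := by
  obtain ⟨i, j, t, h⟩ := augmentedCross_iff.1 h
  obtain ⟨i', j', t', h'⟩ := augmentedCross_iff.1 h'
  obtain ⟨rfl, rfl, rfl⟩ := h.eq_of_row_eq h'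
  rw [h.2.2, h'.2.2]

theorem augmentedCross_col (f : Filling F) (x x' y : ℕ) (h : f.AugmentedCross x y)
    (h' : f.AugmentedCross x' y) : x = x' := by
  obtain ⟨i, j, t, h⟩ := augmentedCross_iff.1 h
  obtain ⟨i', j', t', h'⟩ := augmentedCross_iff.1 h'
  obtain ⟨rfl, rfl, rfl⟩ := h.eq_of_col_eq h'
  have h1 := h.2.1
  have h2 := h'.2.1
  omega

/-! ### The word of a filling and weak duality -/

/-- The columns of the crosses to the left and below of the corner `(r, s)` of the shape. -/
noncomputable def word (f : Filling F) (r s : ℕ) : List ℕ :=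
  crossWord f.AugmentedCross (f.rowStart r) (f.colStart s)

theorem mem_word {r s y : ℕ} :
    y ∈ f.word r s ↔ ∃ i j t x, i < r ∧ j < s ∧ f.IsCross i j t x y := by
  rw [word, mem_crossWord]
  constructor
  · rintro ⟨hy, x, hx, i, j, t, h⟩
    have h : f.IsCross i j t x y := h
    exact ⟨i, j, t, x, h.row_lt_iff.1 hx, h.col_lt_iff.1 hy, h⟩
  · rintro ⟨i, j, t, x, hi, hj, h⟩
    exact ⟨h.col_lt_iff.2 hj, x, h.row_lt_iff.2 hi, i, j, t, h⟩

theorem rel_of_pairwise_word {R : ℕ → ℕ → Prop} {r s : ℕ} (h : (f.word r s).Pairwise R)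
    {i j t x y i' j' t' x' y' : ℕ} (hc : f.IsCross i j t x y) (hc' : f.IsCross i' j' t' x' y')
    (hj : j < s) (hi' : i' < r) (hj' : j' < s) (hx : x < x') : R y y' :=
  rel_of_pairwise_crossWord h hx (hc'.row_lt_iff.2 hi') (hc.col_lt_iff.2 hj)
    (hc'.col_lt_iff.2 hj') ⟨i, j, t, hc⟩ ⟨i', j', t', hc'⟩

/-- The cells to the left and below of the corner `(r, s)`. -/
def region (r s : ℕ) : Finset (ℕ × ℕ) := Finset.range r ×ˢ Finset.range s

theorem mem_region {r s : ℕ} {p : ℕ × ℕ} : p ∈ region r s ↔ p.1 < r ∧ p.2 < s := by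
  simp [region]

theorem entrySum_region_le_length (f : Filling F) (r s : ℕ) :
    f.entrySum (region r s) ≤ (f.word r s).length := by
  classical
  choose! x y hxy using fun (p : ℕ × ℕ) (t : ℕ) (h : t < f.entry p.1 p.2) => exists_isCross h
  calc f.entrySum (region r s)
      = ((region r s).sigma fun p => Finset.range (f.entry p.1 p.2)).card := by
        simp [entrySum]
    _ ≤ (f.word r s).toFinset.card := by
        refine Finset.card_le_card_of_injOn (fun q => y q.1 q.2) ?_ ?_
        · rintro ⟨p, t⟩ hq
          simp only [Finset.coe_sigma, Set.mem_sigma_iff, Finset.mem_coe, mem_region,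
            Finset.mem_range] at hq
          simp only [Finset.mem_coe, List.mem_toFinset, mem_word]
          exact ⟨p.1, p.2, t, x p t, hq.1.1, hq.1.2, hxy p t hq.2⟩
        · rintro ⟨⟨i, j⟩, t⟩ hq ⟨⟨i', j'⟩, t'⟩ hq' h
          simp only [Finset.coe_sigma, Set.mem_sigma_iff, Finset.mem_coe,
            Finset.mem_range] at hq hq' h
          have h1 := hxy (i, j) t hq.2
          rw [h] at h1
          obtain ⟨rfl, rfl, rfl⟩ := h1.eq_of_col_eq (hxy (i', j') t' hq'.2)
          rfl
    _ ≤ _ := List.toFinset_card_le _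

/-- The weak duality between ne-chains and SE-chains. -/
theorem card_add_entrySum_le {r s k l : ℕ}
    {C : Fin k → Finset (ℕ × ℕ)} {A : Fin l → Finset (ℕ × ℕ)} (hC : f.IsNeCollection r s k C)
    (hA : f.IsSECollection r s l A) :
    ∑ a, (C a).card + ∑ b, f.entrySum (A b) ≤ f.entrySum (region r s) + k * l := by
  classical
  set m : ℕ × ℕ → ℕ := fun p => (Finset.univ.filter fun a => p ∈ C a).card with hm
  set n : ℕ × ℕ → ℕ := fun p => (Finset.univ.filter fun b => p ∈ A b).card with hn
  have hCr : ∀ a, C a ⊆ region r s := fun a p hp =>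
    mem_region.2 ⟨((hC.1 a).1 p hp).1, ((hC.1 a).1 p hp).2.1⟩
  have hAr : ∀ b, A b ⊆ region r s := fun b p hp =>
    mem_region.2 ⟨((hA.1 b).1 p hp).1, ((hA.1 b).1 p hp).2.1⟩
  have h1 : ∑ a, (C a).card = ∑ p ∈ region r s, m p := by
    simp only [hm, Finset.card_filter]
    rw [Finset.sum_comm]
    refine Finset.sum_congr rfl fun a _ => ?_
    rw [← Finset.card_filter, Finset.filter_mem_eq_inter, Finset.inter_eq_right.2 (hCr a)]
  have h2 : ∑ b, f.entrySum (A b) = ∑ p ∈ region r s, n p * f.entry p.1 p.2 := by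
    simp only [hn, Finset.card_filter, Finset.sum_mul]
    rw [Finset.sum_comm]
    refine Finset.sum_congr rfl fun b _ => ?_
    simp only [ite_mul, one_mul, zero_mul]
    rw [← Finset.sum_filter, Finset.filter_mem_eq_inter, Finset.inter_eq_right.2 (hAr b)]
    rfl
  have h3 : ∑ p ∈ region r s, m p * n p ≤ k * l := by
    have : ∑ p ∈ region r s, m p * n p = ∑ a, ∑ b, (C a ∩ A b).card := by
      simp only [hm, hn, Finset.card_filter, Finset.sum_mul_sum]
      rw [Finset.sum_comm]
      refine Finset.sum_congr rfl fun a _ => ?_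
      rw [Finset.sum_comm]
      refine Finset.sum_congr rfl fun b _ => ?_
      simp only [ite_mul, one_mul, zero_mul, ← ite_and]
      rw [← Finset.card_filter]
      congr 1
      ext p
      simp only [Finset.mem_filter, Finset.mem_inter, and_iff_right_iff_imp]
      exact fun h => hCr a h.1
    rw [this]
    -- Two distinct cells cannot be in strict ne-position and in weak SE-position at once.
    calc ∑ a, ∑ b, (C a ∩ A b).card ≤ ∑ _a : Fin k, ∑ _b : Fin l, 1 := by
          refine Finset.sum_le_sum fun a _ => Finset.sum_le_sum fun b _ => ?_
          refine Finset.card_le_one.2 fun p hp q hq => ?_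
          rw [Finset.mem_inter] at hp hq
          by_contra hpq
          have h4 := (hC.1 a).2 hp.1 hq.1 hpq
          have h5 := (hA.1 b).2 hp.2 hq.2 hpq
          simp only at h4 h5
          omega
      _ = k * l := by simp
  -- With `e` the entry, this is `(e - m) * (1 - n) ≥ 0`: the ne-chains use a cell at most `e`
  -- times, the disjoint SE-chains at most once.
  have h4 : ∀ p ∈ region r s, m p + n p * f.entry p.1 p.2 ≤ f.entry p.1 p.2 + m p * n p := by
    intro p _
    have h5 : m p ≤ f.entry p.1 p.2 := hC.2 p.1 p.2
    have h6 : n p ≤ 1 := by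
      refine Finset.card_le_one.2 fun a ha b hb => ?_
      simp only [Finset.mem_filter, Finset.mem_univ, true_and] at ha hb
      by_contra hab
      exact Finset.disjoint_left.1 (hA.2 a b hab) ha hb
    interval_cases n p <;> omega
  have h5 := Finset.sum_le_sum h4
  rw [Finset.sum_add_distrib, Finset.sum_add_distrib] at h5
  rw [h1, h2]
  exact h5.trans (Nat.add_le_add_left h3 _)

/-! ### From coloured subsequences to chains -/

theorem exists_cell (f : Filling F) (r s : ℕ) : ∃ (g : ℕ → ℕ × ℕ) (t x : ℕ → ℕ),
    ∀ y ∈ f.word r s, (g y).1 < r ∧ (g y).2 < s ∧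
      f.IsCross (g y).1 (g y).2 (t y) (x y) y := by
  have : ∀ y, ∃ (p : ℕ × ℕ) (t x : ℕ), y ∈ f.word r s → p.1 < r ∧ p.2 < s ∧
      f.IsCross p.1 p.2 t x y := by
    intro y
    by_cases hy : y ∈ f.word r s
    · obtain ⟨i, j, t, x, hi, hj, h⟩ := mem_word.1 hy
      exact ⟨(i, j), t, x, fun _ => ⟨hi, hj, h⟩⟩
    · exact ⟨(0, 0), 0, 0, fun h => absurd h hy⟩
  choose g t x h using this
  exact ⟨g, t, x, h⟩

/-- Crosses of one colour lie in distinct cells, so projecting a colour class to cells loses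
nothing. -/
theorem exists_neCollection {r s k n : ℕ} (h : HasColoring (f.word r s) k n) :
    ∃ C, f.IsNeCollection r s k C ∧ n ≤ ∑ a, (C a).card := by
  classical
  obtain ⟨S, c, hS, hn, hc, hp⟩ := h
  obtain ⟨g, t, x, hg⟩ := f.exists_cell r s
  have hgS : ∀ y ∈ S, _ := fun y hy => hg y (List.mem_toFinset.1 (hS hy))
  have key : ∀ y ∈ S, ∀ y' ∈ S, y ≠ y' → c y = c y' →
      ((g y).1 < (g y').1 ∧ (g y).2 < (g y').2) ∨ ((g y').1 < (g y).1 ∧ (g y').2 < (g y).2) := by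
    intro y hy y' hy' hne hcc
    obtain ⟨h1, h2, h3⟩ := hgS y hy
    obtain ⟨h1', h2', h3'⟩ := hgS y' hy'
    rcases lt_trichotomy (x y) (x y') with hx | hx | hx
    · exact Or.inl (h3.cell_lt h3' hx (rel_of_pairwise_word hp h3 h3' h2 h1' h2' hx hy hy' hcc))
    · rw [← hx] at h3'
      exact absurd (f.augmentedCross_row (x y) y y' ⟨_, _, _, h3⟩ ⟨_, _, _, h3'⟩) hne
    · exact Or.inr (h3'.cell_lt h3 hx
        (rel_of_pairwise_word hp h3' h3 h2' h1 h2 hx hy' hy hcc.symm))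
  refine ⟨fun a => (S.filter fun y => c y = a).image g, ⟨fun a => ⟨fun p hp' => ?_, ?_⟩, ?_⟩, ?_⟩
  · obtain ⟨y, hy, rfl⟩ := Finset.mem_image.1 hp'
    obtain ⟨h1, h2, h3⟩ := hgS y (Finset.mem_filter.1 hy).1
    exact ⟨h1, h2, by have := h3.1; omega⟩
  · intro p hp' q hq hpq
    obtain ⟨y, hy, rfl⟩ := Finset.mem_image.1 (Finset.mem_coe.1 hp')
    obtain ⟨y', hy', rfl⟩ := Finset.mem_image.1 (Finset.mem_coe.1 hq)
    rw [Finset.mem_filter] at hy hy'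
    exact key y hy.1 y' hy'.1 (fun h => hpq (by rw [h])) (by rw [hy.2, hy'.2])
  · intro i j
    have : ∀ a : Fin k, ∃ y, (i, j) ∈ (S.filter fun y => c y = a).image g →
        y ∈ S ∧ c y = a ∧ g y = (i, j) := by
      intro a
      by_cases ha : (i, j) ∈ (S.filter fun y => c y = a).image g
      · obtain ⟨y, hy, hgy⟩ := Finset.mem_image.1 ha
        rw [Finset.mem_filter] at hy
        exact ⟨y, fun _ => ⟨hy.1, hy.2, hgy⟩⟩
      · exact ⟨0, fun h => absurd h ha⟩
    choose z hz using this
    rw [← Finset.card_range (f.entry i j)]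
    -- Different colours use different crosses of the cell `(i, j)`, and these are numbered below
    -- its entry.
    refine Finset.card_le_card_of_injOn (fun a => t (z a)) ?_ ?_
    · intro a ha
      simp only [Finset.coe_filter, Finset.mem_univ, true_and, Set.mem_ofPred_eq] at ha
      obtain ⟨h1, -, h2⟩ := hz a ha
      have := (hgS _ h1).2.2.1
      rw [h2] at this
      exact Finset.mem_coe.2 (Finset.mem_range.2 this)
    · intro a ha b hb hab
      simp only [Finset.coe_filter, Finset.mem_univ, true_and, Set.mem_ofPred_eq] at ha hb hab
      obtain ⟨h1, h2, h3⟩ := hz a ha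
      obtain ⟨h1', h2', h3'⟩ := hz b hb
      have h4 := (hgS _ h1).2.2.2.2
      have h4' := (hgS _ h1').2.2.2.2
      rw [h3, hab] at h4
      rw [h3', ← h4] at h4'
      exact Fin.ext (by rw [← h2, ← h2', h4'])
  · refine hn.trans (le_of_eq ?_)
    rw [Finset.card_eq_sum_card_fiberwise (f := c) (t := Finset.range k)
      (fun y hy => by simpa using hc y hy), Finset.sum_range]
    refine Finset.sum_congr rfl fun a _ => (Finset.card_image_of_injOn ?_).symm
    intro y hy y' hy' hyy
    simp only [Finset.coe_filter, Set.mem_ofPred_eq] at hy hy'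
    by_contra hne
    have := key y hy.1 y' hy'.1 hne (by rw [hy.2, hy'.2])
    rw [hyy] at this
    omega

/-- Crosses of one cell may have several colours, whereas the chains must be disjoint. Each occupied
cell `p` goes entirely to the colour of one chosen cross `z p`; the chain property holds for the
chosen crosses, and every occupied cell contributes its whole entry, which bounds its number of
coloured crosses. -/
theorem exists_seCollection {r s k n : ℕ} (h : HasColoring (f.word r s).reverse k n) :
    ∃ A, f.IsSECollection r s k A ∧ n ≤ ∑ b, f.entrySum (A b) := by
  classical
  obtain ⟨S, c, hS, hn, hc, hp⟩ := h
  rw [List.pairwise_reverse] at hp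
  rw [List.toFinset_reverse] at hS
  obtain ⟨g, t, x, hg⟩ := f.exists_cell r s
  have hgS : ∀ y ∈ S, _ := fun y hy => hg y (List.mem_toFinset.1 (hS hy))
  have key : ∀ y ∈ S, ∀ y' ∈ S, y ≠ y' → c y = c y' →
      ((g y').1 ≤ (g y).1 ∧ (g y).2 ≤ (g y').2) ∨ ((g y).1 ≤ (g y').1 ∧ (g y').2 ≤ (g y).2) := by
    intro y hy y' hy' hne hcc
    obtain ⟨h1, h2, h3⟩ := hgS y hy
    obtain ⟨h1', h2', h3'⟩ := hgS y' hy'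
    rcases lt_trichotomy (x y) (x y') with hx | hx | hx
    · exact Or.inr (h3.cell_le h3' hx
        (rel_of_pairwise_word hp h3 h3' h2 h1' h2' hx hy' hy hcc.symm))
    · rw [← hx] at h3'
      exact absurd (f.augmentedCross_row (x y) y y' ⟨_, _, _, h3⟩ ⟨_, _, _, h3'⟩) hne
    · exact Or.inl (h3'.cell_le h3 hx
        (rel_of_pairwise_word hp h3' h3 h2' h1 h2 hx hy hy' hcc))
  have : ∀ p, ∃ y, p ∈ S.image g → y ∈ S ∧ g y = p := by
    intro p
    by_cases hp' : p ∈ S.image g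
    · obtain ⟨y, hy, h⟩ := Finset.mem_image.1 hp'
      exact ⟨y, fun _ => ⟨hy, h⟩⟩
    · exact ⟨0, fun h => absurd h hp'⟩
  choose z hz using this
  refine ⟨fun b => (S.image g).filter fun p => c (z p) = b,
    ⟨fun b => ⟨fun p hp' => ?_, ?_⟩, ?_⟩, ?_⟩
  · obtain ⟨y, hy, rfl⟩ := Finset.mem_image.1 (Finset.mem_filter.1 hp').1
    obtain ⟨h1, h2, h3⟩ := hgS y hy
    exact ⟨h1, h2, by have := h3.1; omega⟩
  · intro p hp' q hq hpq
    rw [Finset.mem_coe, Finset.mem_filter] at hp' hq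
    obtain ⟨h1, h2⟩ := hz p hp'.1
    obtain ⟨h1', h2'⟩ := hz q hq.1
    have := key _ h1 _ h1' (fun h => hpq (by rw [← h2, ← h2', h])) (by rw [hp'.2, hq.2])
    rwa [h2, h2'] at this
  · intro a b hab
    refine Finset.disjoint_left.2 fun p ha hb => hab ?_
    exact Fin.ext ((Finset.mem_filter.1 ha).2.symm.trans (Finset.mem_filter.1 hb).2)
  · have h1 : ∑ b : Fin k, f.entrySum ((S.image g).filter fun p => c (z p) = b) =
        f.entrySum (S.image g) := by
      simp only [entrySum]
      rw [← Finset.sum_range fun b => ∑ p ∈ (S.image g).filter (fun p => c (z p) = b),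
        f.entry p.1 p.2]
      exact Finset.sum_fiberwise_of_maps_to
        (fun p hp' => Finset.mem_range.2 (hc _ (hz p hp').1)) _
    rw [h1]
    refine hn.trans ?_
    rw [Finset.card_eq_sum_card_image g S]
    refine Finset.sum_le_sum fun p _ => ?_
    rw [← Finset.card_range (f.entry p.1 p.2)]
    refine Finset.card_le_card_of_injOn t ?_ ?_
    · intro y hy
      simp only [Finset.coe_filter, Set.mem_ofPred_eq] at hy
      have := (hgS y hy.1).2.2.1
      rw [hy.2] at this
      exact Finset.mem_coe.2 (Finset.mem_range.2 this)
    · intro y hy y' hy' hyy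
      simp only [Finset.coe_filter, Set.mem_ofPred_eq] at hy hy'
      have h4 := (hgS y hy.1).2.2.2.2
      have h4' := (hgS y' hy'.1).2.2.2.2
      rw [hy.2, hyy] at h4
      rw [hy'.2, ← h4] at h4'
      exact h4'.symm

/-! ### Lower bounds and duality combined -/

theorem exists_neCollection_label (f : Filling F) (r s k : ℕ) :
    ∃ C, f.IsNeCollection r s k C ∧
      ∑ i ∈ Finset.range k, (f.label r s).rowLen i ≤ ∑ a, (C a).card :=
  exists_neCollection
    (hasColoring_crossWord f.augmentedCross_row f.augmentedCross_col _ _ k).1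

theorem exists_seCollection_label (f : Filling F) (r s k : ℕ) :
    ∃ A, f.IsSECollection r s k A ∧
      ∑ j ∈ Finset.range k, (f.label r s).colLen j ≤ ∑ b, f.entrySum (A b) :=
  exists_seCollection
    (hasColoring_crossWord f.augmentedCross_row f.augmentedCross_col _ _ k).2

theorem entrySum_region_le_card_label (f : Filling F) (r s : ℕ) :
    f.entrySum (region r s) ≤ (f.label r s).card :=
  (f.entrySum_region_le_length r s).trans
    (length_crossWord f.augmentedCross_row f.augmentedCross_col _ _).le

theorem isGreatest_neCollection (f : Filling F) (r s k : ℕ) : IsGreatest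
    {n : ℕ | ∃ C : Fin k → Finset (ℕ × ℕ), f.IsNeCollection r s k C ∧ n = ∑ a, (C a).card}
    (∑ i ∈ Finset.range k, (f.label r s).rowLen i) := by
  have hub : ∀ C : Fin k → Finset (ℕ × ℕ), f.IsNeCollection r s k C →
      ∑ a, (C a).card ≤ ∑ i ∈ Finset.range k, (f.label r s).rowLen i := by
    intro C hC
    -- The number $\lambda_{k+1}$ of SE-chains makes the duality tight: a square outside the first
    -- `k` rows then lies in the first $\lambda_{k+1}$ columns, and the rectangle in question is
    -- contained in the label.
    obtain ⟨A, hA, hA'⟩ := f.exists_seCollection_label r s ((f.label r s).rowLen k)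
    have h1 := card_add_entrySum_le hC hA
    have h2 := f.entrySum_region_le_card_label r s
    have h3 := card_add_mul_le (f.label r s) (k := k) (l := (f.label r s).rowLen k)
      (fun i j hij => by
        by_contra h
        have h4 := (f.label r s).rowLen_anti k i (by omega)
        rw [YoungDiagram.mem_iff_lt_rowLen] at hij
        omega)
      (fun i j hi hj => YoungDiagram.mem_iff_lt_rowLen.2
        (hj.trans_le ((f.label r s).rowLen_anti i k hi.le)))
    omega
  constructor
  · obtain ⟨C, hC, hC'⟩ := f.exists_neCollection_label r s k
    exact ⟨C, hC, le_antisymm hC' (hub C hC)⟩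
  · rintro n ⟨C, hC, rfl⟩
    exact hub C hC

theorem isGreatest_seCollection (f : Filling F) (r s k : ℕ) : IsGreatest
    {n : ℕ | ∃ C : Fin k → Finset (ℕ × ℕ), f.IsSECollection r s k C ∧
      n = ∑ a, f.entrySum (C a)}
    (∑ i ∈ Finset.range k, (f.label r s).transpose.rowLen i) := by
  simp only [YoungDiagram.rowLen_transpose]
  have hub : ∀ A : Fin k → Finset (ℕ × ℕ), f.IsSECollection r s k A →
      ∑ b, f.entrySum (A b) ≤ ∑ i ∈ Finset.range k, (f.label r s).colLen i := by
    intro A hA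
    obtain ⟨C, hC, hC'⟩ := f.exists_neCollection_label r s ((f.label r s).colLen k)
    have h1 := card_add_entrySum_le hC hA
    have h2 := f.entrySum_region_le_card_label r s
    have h3 := card_add_mul_le (f.label r s) (k := (f.label r s).colLen k) (l := k)
      (fun i j hij => by
        by_contra h
        have h4 := (f.label r s).colLen_anti k j (by omega)
        rw [YoungDiagram.mem_iff_lt_colLen] at hij
        omega)
      (fun i j hi hj => YoungDiagram.mem_iff_lt_colLen.2
        (hi.trans_le ((f.label r s).colLen_anti j k hj.le)))
    omega
  constructor
  · obtain ⟨A, hA, hA'⟩ := f.exists_seCollection_label r s k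
    exact ⟨A, hA, le_antisymm hA' (hub A hA)⟩
  · rintro n ⟨A, hA, rfl⟩
    exact hub A hA

theorem IsNeChain.isNeCollection {r s : ℕ} {C : Finset (ℕ × ℕ)} (hC : f.IsNeChain r s C) :
    f.IsNeCollection r s 1 fun _ => C := by
  refine ⟨fun _ => hC, fun i j => ?_⟩
  by_cases h : (i, j) ∈ C
  · have := (hC.1 _ h).2.2
    simp only [h, Finset.filter_true, Finset.card_univ, Fintype.card_fin]
    exact Nat.one_le_iff_ne_zero.2 this
  · simp [h]

theorem IsSEChain.isSECollection {r s : ℕ} {C : Finset (ℕ × ℕ)} (hC : f.IsSEChain r s C) :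
    f.IsSECollection r s 1 fun _ => C :=
  ⟨fun _ => hC, fun a b hab => absurd (Subsingleton.elim a b) hab⟩

end Filling

end DualRSK

theorem theorem12 (F : YoungDiagram) (f : DualRSK.Filling F) (r s : ℕ)
    (hc : DualRSK.IsCorner F r s) :
    (∀ k : ℕ, IsGreatest
      {n : ℕ | ∃ C : Fin k → Finset (ℕ × ℕ), f.IsNeCollection r s k C ∧ n = ∑ a, (C a).card}
      (∑ i ∈ Finset.range k, (f.label r s).rowLen i)) ∧
    (∀ k : ℕ, IsGreatest
      {n : ℕ | ∃ C : Fin k → Finset (ℕ × ℕ), f.IsSECollection r s k C ∧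
        n = ∑ a, f.entrySum (C a)}
      (∑ i ∈ Finset.range k, (f.label r s).transpose.rowLen i)) ∧
    IsGreatest {n : ℕ | ∃ C : Finset (ℕ × ℕ), f.IsNeChain r s C ∧ n = C.card}
      ((f.label r s).rowLen 0) ∧
    IsGreatest {n : ℕ | ∃ C : Finset (ℕ × ℕ), f.IsSEChain r s C ∧ n = f.entrySum C}
      ((f.label r s).transpose.rowLen 0) := by
  refine ⟨f.isGreatest_neCollection r s, f.isGreatest_seCollection r s, ?_, ?_⟩
  · have h := f.isGreatest_neCollection r s 1
    rw [Finset.sum_range_one] at h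
    obtain ⟨⟨C, hC, hn⟩, hub⟩ := h
    refine ⟨⟨C 0, hC.1 0, by simpa using hn⟩, ?_⟩
    rintro n ⟨C, hC, rfl⟩
    exact hub ⟨_, hC.isNeCollection, by simp⟩
  · have h := f.isGreatest_seCollection r s 1
    rw [Finset.sum_range_one] at h
    obtain ⟨⟨C, hC, hn⟩, hub⟩ := h
    refine ⟨⟨C 0, hC.1 0, by simpa using hn⟩, ?_⟩
    rintro n ⟨C, hC, rfl⟩
    exact hub ⟨_, hC.isSECollection, by simp⟩
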